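/- Let $\mathbb S^1=\mathbb R/\mathbb Z$ with its standard metric. Let $\mathscr L$ be the class of continuous degree one, weakly order-preserving maps $f:\mathbb S^1\to\mathbb S^1$ for which there are a non-degenerate open arc $U_f$ (the flat interval), the projection of an interval $(a,b)\subset\mathbb R$ with $a<b<a+1$, and a real number $\ell>0$ (the critical exponent) such that, writing $F$ for a lift of $f$ to $\mathbb R$: the derivative of $f$ exists everywhere, is $0$ on $\overline{U_f}$ and is positive off $\overline{U_f}$; $f$ is twice continuously differentiable except possibly at the two end points of $U_f$; $F(x)=h_r\big((x-b)^{\ell}\big)$ on some right-sided neighbourhood of $b$ and $F(x)=h_l\big((a-x)^{\ell}\big)$ on some left-sided neighbourhood of $a$, where $h_r$ and $h_l$ are $C^2$-diffeomorphisms on a neighbourhood of $0$. The rotation number of $f\in\mathscr L$ is $\rho(f)=\lim_{n\to\infty}F^n(x)/n \pmod 1$, taken in $[0,1)$. If $\rho(f)$ is irrational, let $\rho(f)=[0;a_1,a_2,\dots]$ be its continued fraction expansion and define $q_0=1$, $q_1=a_1$, $q_{n+1}=a_{n+1}q_n+q_{n-1}$. The rotation number is of bounded type if the sequence $(a_n)$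 is bounded. The geometry of $f$ is bounded if the scalings $$\tau_n=\frac{\operatorname{dist}\big(U_f,f^{q_n}(U_f)\big)}{\operatorname{dist}\big(U_f,f^{q_{n-2}}(U_f)\big)},\qquad n\ge 2,$$ are bounded away from zero. Let $\mathscr B$ be the class of $f\in\mathscr L$ with irrational rotation number of bounded type and with bounded geometry. The non-wandering set $K_f$ is the set of all $x\in\mathbb S^1$ such that for every open neighbourhood $V$ of $x$ there is an integer $n>0$ with $V\cap f^n(V)\ne\emptyset$; it satisfies $f(K_f)\subseteq K_f$. Let $f,g\in\mathscr B$ have the same (irrational) rotation number. Then there is a homeomorphism $\varphi_0:K_f\to K_g$ such that $\varphi_0\circ f|_{K_f}=g\circ\varphi_0$. -/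

import Mathlib

open Set Filter Topology
open scoped Manifold ContDiff

noncomputable section

/-- The non-wandering set of a self-map `f` of a topological space: the points `x` such that every
open neighbourhood `V` of `x` meets `f^n(V)` for some `n > 0`. -/
def nonwanderingSet {X : Type*} [TopologicalSpace X] (f : X → X) : Set X :=
  {x | ∀ V : Set X, IsOpen V → x ∈ V → ∃ n : ℕ, 0 < n ∧ (V ∩ f^[n] '' V).Nonempty}

/-- The non-wandering set of a continuous map is forward invariant. -/
theorem mapsTo_nonwanderingSet {X : Type*} [TopologicalSpace X] {f : X → X} (hf : Continuous f) :
    MapsTo f (nonwanderingSet f) (nonwanderingSet f) := by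
  intro x hx V hV hxV
  obtain ⟨n, hn, y, hy, z, hz, rfl⟩ := hx (f ⁻¹' V) (hV.preimage hf) hxV
  refine ⟨n, hn, f (f^[n] z), hy, f z, hz, ?_⟩
  rw [← Function.iterate_succ_apply, Function.iterate_succ_apply']

/-- The partial quotients of the continued fraction `[a₀; a₁, a₂, …]` of `ρ`:
`partialQuotient ρ n` is `a_{n+1}`. (The value is a positive integer when `ρ` is irrational.) -/
def partialQuotient (ρ : ℝ) (n : ℕ) : ℕ :=
  ⌊((GenContFract.of ρ).partDens.get? n).getD 0⌋₊

/-- The denominators `q_n` of the convergents of `ρ`: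
`q_0 = 1`, `q_1 = a_1`, `q_{n+2} = a_{n+2} q_{n+1} + q_n`. -/
def convergentDenom (ρ : ℝ) : ℕ → ℕ
  | 0 => 1
  | 1 => partialQuotient ρ 0
  | n + 2 => partialQuotient ρ (n + 1) * convergentDenom ρ (n + 1) + convergentDenom ρ n

/-- `ρ` is of bounded type: its partial quotients `a_1, a_2, …` are bounded. -/
def IsBoundedType (ρ : ℝ) : Prop :=
  ∃ M : ℕ, ∀ n : ℕ, partialQuotient ρ n < M

/-- The distance between two subsets of a metric space. -/
def setDist {X : Type*} [PseudoMetricSpace X] (A B : Set X) : ℝ :=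
  sInf (Set.image2 dist A B)

/-- The class `𝓛` of continuous degree one circle maps with a flat interval, on the circle `ℝ / ℤ`.
The flat interval is the image in the circle of the interval `(a, b)` of the line. -/
structure FlatCircleMap where
  /-- the circle map -/
  toFun : UnitAddCircle → UnitAddCircle
  /-- a lift of the circle map to the line -/
  lift : CircleDeg1Lift
  /-- left end point of the flat interval, in the line -/
  a : ℝ
  /-- right end point of the flat interval, in the line -/
  b : ℝ
  /-- the critical exponent -/
  exponent : ℝ
  continuous_lift : Continuous lift
  coe_lift : ∀ x : ℝ, toFun (x : UnitAddCircle) = ((lift x : ℝ) : UnitAddCircle)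
  a_lt_b : a < b
  b_lt_a_add_one : b < a + 1
  /-- the derivative vanishes on the closure of the flat interval -/
  hasDerivAt_zero : ∀ x ∈ Icc a b, HasDerivAt lift 0 x
  /-- the derivative exists and is positive off the closure of the flat interval -/
  deriv_pos : ∀ x ∈ Ioo b (a + 1), 0 < deriv lift x
  /-- the map is `C²` except at the two end points of the flat interval -/
  contDiffAt : ∀ x : ℝ, (x : UnitAddCircle) ≠ (a : UnitAddCircle) →
    (x : UnitAddCircle) ≠ (b : UnitAddCircle) → ContDiffAt ℝ 2 lift x
  exponent_pos : 0 < exponent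
  /-- on a right-sided neighbourhood of `b` the map is `x ↦ h_r ((x - b) ^ ℓ)` with a
  `C²`-diffeomorphism `h_r` of a neighbourhood of `0` -/
  right_germ : ∃ h : ℝ → ℝ, IsLocalDiffeomorphAt 𝓘(ℝ, ℝ) 𝓘(ℝ, ℝ) 2 h 0 ∧
    ∀ᶠ x in 𝓝[>] b, lift x = h ((x - b) ^ exponent)
  /-- on a left-sided neighbourhood of `a` the map is `x ↦ h_l ((a - x) ^ ℓ)` with a
  `C²`-diffeomorphism `h_l` of a neighbourhood of `0` -/
  left_germ : ∃ h : ℝ → ℝ, IsLocalDiffeomorphAt 𝓘(ℝ, ℝ) 𝓘(ℝ, ℝ) 2 h 0 ∧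
    ∀ᶠ x in 𝓝[<] a, lift x = h ((a - x) ^ exponent)

namespace FlatCircleMap

instance : CoeFun FlatCircleMap (fun _ => UnitAddCircle → UnitAddCircle) := ⟨toFun⟩

/-- The flat interval `U_f`. -/
def flatInterval (f : FlatCircleMap) : Set UnitAddCircle :=
  (fun x : ℝ => (x : UnitAddCircle)) '' Ioo f.a f.b

/-- The rotation number of `f`, as its representative in `[0, 1)`. Mathlib's translation number of
the lift `F` is the limit of `F^n(x) / n`, for every `x`. -/
def rotationNumber (f : FlatCircleMap) : ℝ :=
  Int.fract f.lift.translationNumber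

/-- The scaling `τ_n = |f^0, f^{q_n}| / |f^0, f^{q_{n-2}}|` for `n ≥ 2`, where `f^i` stands for
`f^i(U_f)`: `f.scaling n` is `τ_{n+2}`. -/
def scaling (f : FlatCircleMap) (n : ℕ) : ℝ :=
  setDist f.flatInterval (f^[convergentDenom f.rotationNumber (n + 2)] '' f.flatInterval) /
    setDist f.flatInterval (f^[convergentDenom f.rotationNumber n] '' f.flatInterval)

/-- The geometry of `f` is bounded: the scalings are bounded away from zero. -/
def HasBoundedGeometry (f : FlatCircleMap) : Prop :=
  ∃ c : ℝ, 0 < c ∧ ∀ n : ℕ, c ≤ f.scaling n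

/-- The class `𝓑`: maps in `𝓛` with irrational rotation number of bounded type and with bounded
geometry. -/
structure IsClassB (f : FlatCircleMap) : Prop where
  irrational : Irrational f.rotationNumber
  boundedType : IsBoundedType f.rotationNumber
  boundedGeometry : f.HasBoundedGeometry

theorem continuous (f : FlatCircleMap) : Continuous f := by
  refine (QuotientAddGroup.isQuotientMap_mk (N := AddSubgroup.zmultiples (1 : ℝ))).continuous_iff.2
    ?_
  have h : (f.toFun ∘ fun x : ℝ => (x : UnitAddCircle)) =
      fun x : ℝ => ((f.lift x : ℝ) : UnitAddCircle) := funext f.coe_lift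
  exact h ▸ (AddCircle.continuous_mk' (1 : ℝ)).comp f.continuous_lift

/-- The non-wandering set `K_f`. -/
def K (f : FlatCircleMap) : Set UnitAddCircle := nonwanderingSet f

/-- The restriction of `f` to a self-map of `K_f`. -/
def restrictK (f : FlatCircleMap) : f.K → f.K :=
  (mapsTo_nonwanderingSet f.continuous).restrict f f.K f.K

end FlatCircleMap

end

/-! A lift `F` of `f` has irrational translation number `τ`, so there is a continuous monotone
degree one map `H` with `H (F x) = H x + τ`. The fibres of `H` are compact intervals, and `F`, being
monotone and onto, carries left ends of fibres to left ends and right ends to right ends. The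
interior of a fibre wanders, since a return would make a multiple of `τ` an integer; near an end
point `H` is not constant, so the recurrence of the rotation brings nearby points back. Hence `K_f`
is the set of end points of fibres (`coe_mem_K_iff`), and it suffices that the nondegenerate fibres
for `f` and for `g` correspond under a translation.

The fibre containing the flat interval is nondegenerate, and so are the fibres that the rotation
eventually brings onto it. The heart of the proof is that there are no others
(`exists_space_around_fibre`). Take a nondegenerate fibre that never meets the flat interval, and
the shortest of its first `N` images, `N` a record time of the rotation. Nearby on both sides lie
other images, no shorter, so a cross-ratio around the shortest one is at least `1 / 4`. On the way
there from time `0` the intervals involved cover no point more than five times, and at most five of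
them meet the flat interval. Away from it `F' = G / w²` with `w` convex and `log G` Lipschitz, so a
cross-ratio grows by at most `exp (C * length)`; in the exceptional steps it grows by at most a
constant, as the middle interval still avoids the flat part. The original fibre thus has space
beside it comparable to its own length inside arbitrarily short arcs of the rotation, which is
impossible.

The translation taking `H₁ f.b` to `H₂ g.b` then matches nondegenerate fibres. Affine maps between
matched fibres fit together to a homeomorphism of the circle, which is a conjugacy on the end
points. -/

/-! ### Cross-ratio distortion by comparison with Möbius maps -/

/-- If the derivative of `F` is at least `m / l²` with `l` affine and positive, then the increment
of `F` is at least that of `m` times the Möbius map with derivative `1 / l²`. -/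
theorem mobius_increment_le {F F' : ℝ → ℝ} {x y p k m : ℝ} (hxy : x ≤ y)
    (hF : ∀ t ∈ Icc x y, HasDerivAt F (F' t) t)
    (hpos : ∀ t ∈ Icc x y, 0 < p + k * (t - x))
    (hle : ∀ t ∈ Icc x y, m / (p + k * (t - x)) ^ 2 ≤ F' t) :
    m * ((y - x) / (p * (p + k * (y - x)))) ≤ F y - F x := by
  have hp : 0 < p := by simpa using hpos x ⟨le_rfl, hxy⟩
  have hM : ∀ t ∈ Icc x y, HasDerivAt (fun t => (t - x) / (p * (p + k * (t - x))))
      (1 / (p + k * (t - x)) ^ 2) t := by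
    intro t ht
    have h1 := hpos t ht
    have hd : HasDerivAt (fun t : ℝ => t - x) 1 t := (hasDerivAt_id t).sub_const x
    have hd2 := ((hd.const_mul k).const_add p).const_mul p
    refine (hd.div hd2 (by positivity)).congr_deriv ?_
    field_simp
    ring
  have key : MonotoneOn (fun t => F t - m * ((t - x) / (p * (p + k * (t - x))))) (Icc x y) := by
    have hd : ∀ t ∈ Icc x y, HasDerivAt
        (fun t => F t - m * ((t - x) / (p * (p + k * (t - x)))))
        (F' t - m * (1 / (p + k * (t - x)) ^ 2)) t :=
      fun t ht => (hF t ht).sub ((hM t ht).const_mul m)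
    refine monotoneOn_of_deriv_nonneg (convex_Icc x y)
      (fun t ht => (hd t ht).continuousAt.continuousWithinAt)
      (fun t ht => (hd t (interior_subset ht)).differentiableAt.differentiableWithinAt) ?_
    intro t ht
    rw [(hd t (interior_subset ht)).deriv, sub_nonneg, mul_one_div]
    exact hle t (interior_subset ht)
  have := key ⟨le_rfl, hxy⟩ ⟨hxy, le_rfl⟩ hxy
  simp only [sub_self, zero_div, mul_zero, sub_zero] at this
  linarith

/-- The upper bound corresponding to `mobius_increment_le`. -/
theorem increment_le_mobius {F F' : ℝ → ℝ} {x y p k m : ℝ} (hxy : x ≤ y)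
    (hF : ∀ t ∈ Icc x y, HasDerivAt F (F' t) t)
    (hpos : ∀ t ∈ Icc x y, 0 < p + k * (t - x))
    (hle : ∀ t ∈ Icc x y, F' t ≤ m / (p + k * (t - x)) ^ 2) :
    F y - F x ≤ m * ((y - x) / (p * (p + k * (y - x)))) := by
  have := mobius_increment_le (F := fun t => -F t) (F' := fun t => -F' t) (m := -m) hxy
    (fun t ht => (hF t ht).neg) hpos (fun t ht => by
      rw [neg_div]; exact neg_le_neg (hle t ht))
  linarith

/-- One half of the cross-ratio inequality for maps with `F' = G / w²`, `w` convex. -/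
theorem slope_mul_le_of_convexOn {F G w : ℝ → ℝ} {s : Set ℝ} {a b c m M : ℝ}
    (hw : ConvexOn ℝ s w) (hw0 : ∀ x ∈ s, 0 < w x)
    (hF : ∀ x ∈ s, HasDerivAt F (G x / w x ^ 2) x)
    (hab : a < b) (hbc : b < c) (hs : Icc a c ⊆ s) (hm : 0 < m) (hmM : m ≤ M)
    (hGm : ∀ x ∈ Icc a c, m ≤ G x) (hGM : ∀ x ∈ Icc a c, G x ≤ M) :
    m * w b * ((c - a) * (F b - F a)) ≤ M * w c * ((b - a) * (F c - F a)) := by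
  have hM : 0 < M := hm.trans_le hmM
  have sa : a ∈ s := hs ⟨le_rfl, (hab.trans hbc).le⟩
  have sb : b ∈ s := hs ⟨hab.le, hbc.le⟩
  have sc : c ∈ s := hs ⟨(hab.trans hbc).le, le_rfl⟩
  have wb := hw0 b sb
  have wc := hw0 c sc
  -- The affine function through the graph of `w` at `b` and `c` lies above `w` between these points
  -- and below `w` to the left of `b`. Its Möbius map therefore bounds `F` from below on `[b, c]`
  -- and from above on `[a, b]`.
  set k := (w c - w b) / (c - b) with hk
  have hkc : w b + k * (c - b) = w c := by
    rw [hk, div_mul_cancel₀ _ (sub_pos.2 hbc).ne']; ring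
  -- the chord lies above `w` between `b` and `c`
  have above : ∀ t ∈ Icc b c, w t ≤ w b + k * (t - b) := by
    intro t ht
    rcases ht.1.eq_or_lt with rfl | hbt
    · simp
    rcases ht.2.eq_or_lt with rfl | htc
    · rw [hkc]
    have := hw.secant_mono_aux1 sb sc hbt htc
    have h2 : w b + k * (t - b) = ((c - t) * w b + (t - b) * w c) / (c - b) := by
      rw [hk, eq_div_iff (sub_pos.2 hbc).ne', add_mul, mul_assoc, mul_comm (t - b), ← mul_assoc,
        div_mul_cancel₀ _ (sub_pos.2 hbc).ne']
      ring
    rw [h2, le_div_iff₀ (sub_pos.2 hbc)]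
    linarith
  have below : ∀ t ∈ Icc a b, w b + k * (t - b) ≤ w t := by
    intro t ht
    rcases ht.2.eq_or_lt with rfl | htb
    · simp
    have ts : t ∈ s := hs ⟨ht.1, ht.2.trans hbc.le⟩
    have := hw.secant_mono_aux1 ts sc htb hbc
    have h3 : (c - t) * w b ≤ (c - b) * w t + (b - t) * w c := by linarith
    have hcb := sub_pos.2 hbc
    have h4 : (c - b) * (w b + k * (t - b)) ≤ (c - b) * w t := by
      have : (c - b) * (w b + k * (t - b)) = (c - b) * w b + ((c - b) * k) * (t - b) := by ring
      rw [this, hk, mul_div_cancel₀ _ hcb.ne']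
      linarith
    exact le_of_mul_le_mul_left h4 hcb
  have hFbc : m * ((c - b) / (w b * w c)) ≤ F c - F b := by
    have pos : ∀ t ∈ Icc b c, 0 < w b + k * (t - b) := fun t ht =>
      (hw0 t (hs ⟨hab.le.trans ht.1, ht.2⟩)).trans_le (above t ht)
    have := mobius_increment_le (F := F) (F' := fun x => G x / w x ^ 2) (m := m) hbc.le
      (fun t ht => hF t (hs ⟨hab.le.trans ht.1, ht.2⟩)) pos (fun t ht => by
        have h0 := hw0 t (hs ⟨hab.le.trans ht.1, ht.2⟩)
        have h1 := hGm t ⟨hab.le.trans ht.1, ht.2⟩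
        have h2 := above t ht
        have h3 := pos t ht
        exact div_le_div₀ (hm.le.trans h1) h1 (by positivity) (by gcongr))
    rwa [hkc] at this
  have hFab0 : 0 ≤ F b - F a := by
    -- With `m = 0` the comparison only says that `F` increases.
    have := mobius_increment_le (F := F) (F' := fun x => G x / w x ^ 2) (m := 0) (p := 1) (k := 0)
      hab.le (fun t ht => hF t (hs ⟨ht.1, ht.2.trans hbc.le⟩)) (by simp) (fun t ht => by
        have h1 := hGm t ⟨ht.1, ht.2.trans hbc.le⟩
        have h0 := hw0 t (hs ⟨ht.1, ht.2.trans hbc.le⟩)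
        have := hm.le.trans h1
        simp only [zero_div]
        positivity)
    simpa using this
  have hcb := sub_pos.2 hbc
  have hba := sub_pos.2 hab
  set la := w b + k * (a - b) with hla
  have hid : w b * (c - a) = w c * (b - a) + (c - b) * la := by
    have : (c - b) * k = w c - w b := by rw [hk, mul_div_cancel₀ _ hcb.ne']
    rw [hla]
    linear_combination (b - a) * this
  have hFbc0 : 0 ≤ F c - F b := le_trans (by positivity) hFbc
  -- `la` is the value of the affine function at `a`. If it is not positive there is no Möbius
  -- comparison on `[a, b]`, but then `hid` alone suffices.
  rcases le_or_gt la 0 with hl | hl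
  · have h1 : w b * (c - a) ≤ w c * (b - a) := by
      rw [hid]; nlinarith
    have h0 : 0 ≤ w b * (c - a) := mul_nonneg wb.le (by linarith)
    calc m * w b * ((c - a) * (F b - F a)) = m * (w b * (c - a)) * (F b - F a) := by ring
      _ ≤ M * (w c * (b - a)) * (F c - F a) := by
        gcongr ?_ * ?_
        · gcongr
        · linarith
      _ = _ := by ring
  · have key : F b - F a ≤ M * ((b - a) / (la * w b)) := by
      have aux : ∀ t, la + k * (t - a) = w b + k * (t - b) := fun t => by rw [hla]; ring
      have pos : ∀ t ∈ Icc a b, 0 < la + k * (t - a) := by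
        intro t ht
        rcases le_or_gt 0 k with h | h
        · have := mul_nonneg h (sub_nonneg.2 ht.1)
          linarith
        · rw [aux]
          have := mul_nonneg_of_nonpos_of_nonpos h.le (sub_nonpos.2 ht.2)
          linarith
      have := increment_le_mobius (F := F) (F' := fun x => G x / w x ^ 2) (m := M) hab.le
        (fun t ht => hF t (hs ⟨ht.1, ht.2.trans hbc.le⟩)) pos (fun t ht => by
          have h1 := hGM t ⟨ht.1, ht.2.trans hbc.le⟩
          have h2 := below t ht
          have h3 := pos t ht
          rw [aux] at h3 ⊢
          exact div_le_div₀ hM.le h1 (by positivity) (by gcongr))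
      rwa [aux b, sub_self, mul_zero, add_zero] at this
    -- multiply out
    have k1 : la * w b * (F b - F a) ≤ M * (b - a) := by
      rw [mul_div_assoc', le_div_iff₀ (by positivity)] at key
      linarith
    have k2 : m * (c - b) ≤ w b * w c * (F c - F b) := by
      rw [mul_div_assoc', div_le_iff₀ (by positivity)] at hFbc
      linarith
    have k3 : m * (c - b) * la * (F b - F a) ≤ M * w c * (b - a) * (F c - F b) := by
      refine le_of_mul_le_mul_left ?_ wb
      calc w b * (m * (c - b) * la * (F b - F a)) = (m * (c - b)) * (la * w b * (F b - F a)) := by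
            ring
        _ ≤ (w b * w c * (F c - F b)) * (M * (b - a)) := by
          refine mul_le_mul k2 k1 (by positivity) (by positivity)
        _ = _ := by ring
    have k4 : m * (w c * (b - a)) * (F b - F a) ≤ M * (w c * (b - a)) * (F b - F a) := by
      gcongr
    calc m * w b * ((c - a) * (F b - F a)) = m * (w b * (c - a)) * (F b - F a) := by ring
      _ = m * (w c * (b - a)) * (F b - F a) + m * (c - b) * la * (F b - F a) := by rw [hid]; ring
      _ ≤ M * (w c * (b - a)) * (F b - F a) + M * w c * (b - a) * (F c - F b) := by linarith
      _ = _ := by ring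

theorem HasDerivAt.neg_comp_neg {F : ℝ → ℝ} {F' x : ℝ} (h : HasDerivAt F F' (-x)) :
    HasDerivAt (fun y => -F (-y)) F' x := by
  have h2 : HasDerivAt (fun y : ℝ => -y) (-1) x := hasDerivAt_neg x
  exact (HasDerivAt.comp x h h2).neg.congr_deriv (by simp)

theorem ConvexOn.comp_neg_real {w : ℝ → ℝ} {s : Set ℝ} (hw : ConvexOn ℝ s w) :
    ConvexOn ℝ (-s) fun x => w (-x) :=
  hw.comp_linearMap (-LinearMap.id)

/-- The mirror image of `slope_mul_le_of_convexOn`. -/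
theorem slope_mul_le_of_convexOn' {F G w : ℝ → ℝ} {s : Set ℝ} {b c d m M : ℝ}
    (hw : ConvexOn ℝ s w) (hw0 : ∀ x ∈ s, 0 < w x)
    (hF : ∀ x ∈ s, HasDerivAt F (G x / w x ^ 2) x)
    (hbc : b < c) (hcd : c < d) (hs : Icc b d ⊆ s) (hm : 0 < m) (hmM : m ≤ M)
    (hGm : ∀ x ∈ Icc b d, m ≤ G x) (hGM : ∀ x ∈ Icc b d, G x ≤ M) :
    m * w c * ((d - b) * (F d - F c)) ≤ M * w b * ((d - c) * (F d - F b)) := by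
  have hmem : ∀ {x}, x ∈ Icc (-d) (-b) → -x ∈ Icc b d := fun {x} hx =>
    ⟨by linarith [hx.2], by linarith [hx.1]⟩
  have := slope_mul_le_of_convexOn (F := fun y => -F (-y)) (G := fun x => G (-x)) (a := -d)
    (b := -c) (c := -b) hw.comp_neg_real (fun x hx => hw0 _ hx)
    (fun x hx => (hF _ hx).neg_comp_neg) (by linarith) (by linarith)
    (fun x hx => hs (hmem hx)) hm hmM (fun x hx => hGm _ (hmem hx)) (fun x hx => hGM _ (hmem hx))
  simp only [neg_neg] at this
  calc _ = m * w c * ((-b - -d) * (-F c - -F d)) := by ring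
    _ ≤ _ := this
    _ = _ := by ring

/-- Cross-ratio inequality for maps with `F' = G / w²`, `w` convex. -/
theorem crossRatio_le_of_convexOn {F G w : ℝ → ℝ} {s : Set ℝ} {a b c d m M : ℝ}
    (hw : ConvexOn ℝ s w) (hw0 : ∀ x ∈ s, 0 < w x)
    (hF : ∀ x ∈ s, HasDerivAt F (G x / w x ^ 2) x)
    (hab : a < b) (hbc : b < c) (hcd : c < d) (hs : Icc a d ⊆ s) (hm : 0 < m) (hmM : m ≤ M)
    (hGm : ∀ x ∈ Icc a d, m ≤ G x) (hGM : ∀ x ∈ Icc a d, G x ≤ M)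
    (hFab : F a ≤ F b) (hFbc : F b ≤ F c) (hFcd : F c ≤ F d) :
    m ^ 2 * (((c - a) * (d - b)) * ((F b - F a) * (F d - F c))) ≤
      M ^ 2 * (((b - a) * (d - c)) * ((F c - F a) * (F d - F b))) := by
  have h1 := slope_mul_le_of_convexOn hw hw0 hF hab hbc
    ((Icc_subset_Icc_right hcd.le).trans hs) hm hmM
    (fun x hx => hGm x ⟨hx.1, hx.2.trans hcd.le⟩) (fun x hx => hGM x ⟨hx.1, hx.2.trans hcd.le⟩)
  have h2 := slope_mul_le_of_convexOn' hw hw0 hF hbc hcd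
    ((Icc_subset_Icc_left hab.le).trans hs) hm hmM
    (fun x hx => hGm x ⟨hab.le.trans hx.1, hx.2⟩) (fun x hx => hGM x ⟨hab.le.trans hx.1, hx.2⟩)
  have wb := hw0 b (hs ⟨hab.le, (hbc.trans hcd).le⟩)
  have wc := hw0 c (hs ⟨(hab.trans hbc).le, hcd.le⟩)
  have hM := hm.trans_le hmM
  have h3 := mul_le_mul h1 h2
    (mul_nonneg (by positivity) (mul_nonneg (by linarith) (by linarith)))
    (mul_nonneg (by positivity) (mul_nonneg (by linarith) (by linarith)))
  refine le_of_mul_le_mul_left ?_ (mul_pos wb wc)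
  linarith

/-! ### Maps with power law behaviour at the ends of the flat part -/

/-- On `(α, β)` the map `F` has derivative `((x - α) (β - x)) ^ p * G x` with `G` positive and
`log G` Lipschitz: power law behaviour of `F` at the two end points. -/
structure HasPowerLawDeriv (F G : ℝ → ℝ) (α β p C : ℝ) : Prop where
  exponent_nonneg : 0 ≤ p
  const_nonneg : 0 ≤ C
  hasDerivAt : ∀ x ∈ Ioo α β, HasDerivAt F (((x - α) * (β - x)) ^ p * G x) x
  pos : ∀ x ∈ Ioo α β, 0 < G x
  le_exp : ∀ x ∈ Ioo α β, ∀ y ∈ Ioo α β, G x ≤ Real.exp (C * |x - y|) * G y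

namespace HasPowerLawDeriv

variable {F G : ℝ → ℝ} {α β p C : ℝ}

/-- The weight is symmetric in the two end points, so estimates at the right end follow from those
at the left. -/
theorem mirror (h : HasPowerLawDeriv F G α β p C) :
    HasPowerLawDeriv (fun x => -F (-x)) (fun x => G (-x)) (-β) (-α) p C := by
  have hmem : ∀ {x}, x ∈ Ioo (-β) (-α) → -x ∈ Ioo α β := fun {x} hx =>
    ⟨by linarith [hx.2], by linarith [hx.1]⟩
  refine ⟨h.exponent_nonneg, h.const_nonneg, fun x hx => ?_, fun x hx => h.pos _ (hmem hx),
    fun x hx y hy => ?_⟩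
  · refine (h.hasDerivAt _ (hmem hx)).neg_comp_neg.congr_deriv ?_
    congr 2
    ring
  · have := h.le_exp _ (hmem hx) _ (hmem hy)
    rwa [neg_sub_neg, abs_sub_comm] at this

theorem mul_pos_of_mem {x : ℝ} (hx : x ∈ Ioo α β) : 0 < (x - α) * (β - x) :=
  mul_pos (sub_pos.2 hx.1) (sub_pos.2 hx.2)

/-- This is the `w` with `w⁻² = ((x - α) (β - x)) ^ p`. Its logarithm is `-p / 2` times a sum of
concave logarithms, hence convex, and so is its exponential. -/
theorem convexOn_weight (hp : 0 ≤ p) :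
    ConvexOn ℝ (Ioo α β) fun x => Real.exp (-(p / 2) * Real.log ((x - α) * (β - x))) := by
  have hconc : ConcaveOn ℝ (Ioo α β) fun x => Real.log ((x - α) * (β - x)) := by
    have h1 : ConcaveOn ℝ (Ioo α β) fun x : ℝ => Real.log (x - α) := by
      have := strictConcaveOn_log_Ioi.concaveOn.comp_affineMap
        (AffineMap.id ℝ ℝ - AffineMap.const ℝ ℝ α)
      exact this.subset (fun x hx => sub_pos.2 hx.1) (convex_Ioo α β)
    have h2 : ConcaveOn ℝ (Ioo α β) fun x : ℝ => Real.log (β - x) := by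
      have := strictConcaveOn_log_Ioi.concaveOn.comp_affineMap
        (AffineMap.const ℝ ℝ β - AffineMap.id ℝ ℝ)
      exact this.subset (fun x hx => sub_pos.2 hx.2) (convex_Ioo α β)
    refine (h1.add h2).congr fun x hx => ?_
    exact (Real.log_mul (sub_pos.2 hx.1).ne' (sub_pos.2 hx.2).ne').symm
  have h3 : ConvexOn ℝ (Ioo α β) fun x => -(p / 2) * Real.log ((x - α) * (β - x)) := by
    have := (hconc.neg).smul (c := p / 2) (by positivity)
    refine this.congr fun x _ => ?_
    simp
  refine ⟨convex_Ioo α β, fun x hx y hy s t hs ht hst => ?_⟩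
  exact (Real.exp_le_exp.2 (h3.2 hx hy hs ht hst)).trans
    (convexOn_exp.2 (mem_univ _) (mem_univ _) hs ht hst)

theorem strictMonoOn (h : HasPowerLawDeriv F G α β p C) : StrictMonoOn F (Ioo α β) := by
  refine strictMonoOn_of_deriv_pos (convex_Ioo α β)
    (fun x hx => (h.hasDerivAt x hx).continuousAt.continuousWithinAt) fun x hx => ?_
  rw [interior_Ioo] at hx
  rw [(h.hasDerivAt x hx).deriv]
  exact mul_pos (Real.rpow_pos_of_pos (mul_pos_of_mem hx) _) (h.pos x hx)

/-- Cross-ratios are distorted little when the interval avoids the flat part. -/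
theorem crossRatio_le_exp (h : HasPowerLawDeriv F G α β p C) {a b c d : ℝ}
    (hab : a < b) (hbc : b < c) (hcd : c < d) (ha : α < a) (hd : d < β) :
    ((c - a) * (d - b)) * ((F b - F a) * (F d - F c)) ≤
      Real.exp (4 * C * (d - a)) * (((b - a) * (d - c)) * ((F c - F a) * (F d - F b))) := by
  have hs : Icc a d ⊆ Ioo α β := fun x hx => ⟨ha.trans_le hx.1, hx.2.trans_lt hd⟩
  have hmono := h.strictMonoOn.monotoneOn
  have sa : a ∈ Ioo α β := hs ⟨le_rfl, (hab.trans (hbc.trans hcd)).le⟩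
  have sb : b ∈ Ioo α β := hs ⟨hab.le, (hbc.trans hcd).le⟩
  have sc : c ∈ Ioo α β := hs ⟨(hab.trans hbc).le, hcd.le⟩
  have sd : d ∈ Ioo α β := hs ⟨(hab.trans (hbc.trans hcd)).le, le_rfl⟩
  have hGa := h.pos a sa
  have had : 0 ≤ d - a := by linarith
  have hC := h.const_nonneg
  -- On `[a, d]` the logarithm of `G` differs from its value at `a` by at most `C * (d - a)`, so `M²
  -- / m² = exp (4 * C * (d - a))`.
  have key := crossRatio_le_of_convexOn (F := F) (G := G) (convexOn_weight h.exponent_nonneg)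
    (fun x _ => Real.exp_pos _) (fun x hx => (h.hasDerivAt x hx).congr_deriv ?_) hab hbc hcd hs
    (m := G a * Real.exp (-(C * (d - a)))) (M := G a * Real.exp (C * (d - a)))
    (by positivity) (by
      gcongr
      have := mul_nonneg hC had
      linarith) ?_ ?_
    (hmono sa sb hab.le) (hmono sb sc hbc.le) (hmono sc sd hcd.le)
  · refine le_of_mul_le_mul_left ?_ (show 0 < (G a * Real.exp (-(C * (d - a)))) ^ 2 by positivity)
    refine key.trans (le_of_eq ?_)
    have : Real.exp (C * (d - a)) ^ 2 =
        Real.exp (-(C * (d - a))) ^ 2 * Real.exp (4 * C * (d - a)) := by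
      rw [← Real.exp_nat_mul, ← Real.exp_nat_mul, ← Real.exp_add]
      congr 1
      push_cast
      ring
    rw [mul_pow, mul_pow, this]
    ring
  · rw [Real.rpow_def_of_pos (mul_pos_of_mem hx), ← Real.exp_nat_mul, eq_div_iff (Real.exp_pos _).ne',
      mul_right_comm, ← Real.exp_add]
    convert one_mul _
    rw [Real.exp_eq_one_iff]
    push_cast
    ring
  · intro x hx
    have h1 := h.le_exp a sa x (hs hx)
    rw [Real.exp_neg, ← div_eq_mul_inv, div_le_iff₀ (Real.exp_pos _)]
    refine h1.trans ?_
    rw [mul_comm]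
    have := (h.pos x (hs hx)).le
    gcongr
    rw [abs_sub_comm, abs_of_nonneg (by linarith [hx.1])]
    linarith [hx.2]
  · intro x hx
    have h1 := h.le_exp x (hs hx) a sa
    refine h1.trans ?_
    rw [mul_comm]
    gcongr
    rw [abs_of_nonneg (by linarith [hx.1])]
    linarith [hx.2]

/-- The slope of `F` on an initial segment is at most a multiple of the slope on the whole. -/
theorem slope_le_const (h : HasPowerLawDeriv F G α β p C) (hc : ContinuousOn F (Ico α β))
    {a b c : ℝ} (ha : α ≤ a) (hab : a < b) (hbc : b < c) (hcβ : c < β) :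
    (c - a) * (F b - F a) ≤
      (2 ^ (p + 1) * Real.exp (2 * C * (β - α))) * ((b - a) * (F c - F a)) := by
  have hp := h.exponent_nonneg
  have hC := h.const_nonneg
  have hsub : Ioo a c ⊆ Ioo α β := fun x hx => ⟨ha.trans_lt hx.1, hx.2.trans hcβ⟩
  have hcc : ContinuousOn F (Icc a c) :=
    hc.mono fun x hx => ⟨ha.trans hx.1, hx.2.trans_lt hcβ⟩
  have bmem : b ∈ Ioo α β := hsub ⟨hab, hbc⟩
  -- Let `U` be the maximum of the weight on `[a, c]`. It bounds the slope on `[a, b]` from above.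
  -- Halving `[a, c]` towards the maximum point keeps the weight at least `U / 2` on an interval of
  -- half the length, which costs the factor `2 ^ (p + 1)`.
  obtain ⟨x₀, hx₀, hmax⟩ := isCompact_Icc.exists_isMaxOn (nonempty_Icc.2 (hab.trans hbc).le)
    (show ContinuousOn (fun x => (x - α) * (β - x)) (Icc a c) by fun_prop)
  have hmax' : ∀ x ∈ Icc a c, (x - α) * (β - x) ≤ (x₀ - α) * (β - x₀) := fun x hx => hmax hx
  have hU : 0 < (x₀ - α) * (β - x₀) :=
    (mul_pos_of_mem bmem).trans_le (hmax' b ⟨hab.le, hbc.le⟩)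
  set U := (x₀ - α) * (β - x₀) with hUdef
  set E := Real.exp (C * (β - α)) with hE
  have hE0 : 0 < E := Real.exp_pos _
  have hGb := h.pos b bmem
  have hcomp : ∀ x ∈ Ioo α β, ∀ y ∈ Ioo α β, G x ≤ E * G y := by
    intro x hx y hy
    refine (h.le_exp x hx y hy).trans ?_
    have := (h.pos y hy).le
    refine mul_le_mul_of_nonneg_right (Real.exp_le_exp.2 (mul_le_mul_of_nonneg_left ?_ hC)) this
    rw [abs_le]
    constructor <;> linarith [hx.1, hx.2, hy.1, hy.2]
  have upper : F b - F a ≤ U ^ p * (E * G b) * (b - a) := by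
    obtain ⟨t, ht, hd⟩ := exists_hasDerivAt_eq_slope F _ hab
      (hcc.mono (Icc_subset_Icc_right hbc.le))
      (fun x hx => h.hasDerivAt x (hsub ⟨hx.1, hx.2.trans hbc⟩))
    have ht' : t ∈ Ioo a c := ⟨ht.1, ht.2.trans hbc⟩
    rw [eq_div_iff (sub_pos.2 hab).ne'] at hd
    rw [← hd]
    have h0 := mul_pos_of_mem (hsub ht')
    have h1 := hmax' t (Ioo_subset_Icc_self ht')
    have h2 := hcomp t (hsub ht') b bmem
    have h3 := h.pos t (hsub ht')
    have := sub_nonneg.2 hab.le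
    gcongr
  have lower : (U / 2) ^ p * (G b / E) * ((c - a) / 2) ≤ F c - F a := by
    have hlt : (a + x₀) / 2 < (x₀ + c) / 2 := by linarith
    have hsub2 : Icc ((a + x₀) / 2) ((x₀ + c) / 2) ⊆ Icc a c := fun x hx =>
      ⟨by linarith [hx.1, hx₀.1], by linarith [hx.2, hx₀.2]⟩
    have hsub3 : Ioo ((a + x₀) / 2) ((x₀ + c) / 2) ⊆ Ioo a c := fun x hx =>
      ⟨by linarith [hx.1, hx₀.1], by linarith [hx.2, hx₀.2]⟩
    obtain ⟨t, ht, hd⟩ := exists_hasDerivAt_eq_slope F _ hlt (hcc.mono hsub2)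
      (fun x hx => h.hasDerivAt x (hsub (hsub3 hx)))
    rw [eq_div_iff (sub_pos.2 hlt).ne'] at hd
    have hmono : MonotoneOn F (Icc a c) := by
      refine monotoneOn_of_deriv_nonneg (convex_Icc a c) hcc ?_ ?_ <;> rw [interior_Icc]
      · exact fun x hx => (h.hasDerivAt x (hsub hx)).differentiableAt.differentiableWithinAt
      · intro x hx
        rw [(h.hasDerivAt x (hsub hx)).deriv]
        exact mul_nonneg (Real.rpow_nonneg (mul_pos_of_mem (hsub hx)).le _) (h.pos x (hsub hx)).le
    have hac : a ≤ c := (hab.trans hbc).le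
    have m1 := hmono ⟨le_rfl, hac⟩ (hsub2 ⟨le_rfl, hlt.le⟩) (hsub2 ⟨le_rfl, hlt.le⟩).1
    have m2 := hmono (hsub2 ⟨hlt.le, le_rfl⟩) ⟨hac, le_rfl⟩ (hsub2 ⟨hlt.le, le_rfl⟩).2
    refine le_trans ?_ (show F ((x₀ + c) / 2) - F ((a + x₀) / 2) ≤ F c - F a by linarith)
    rw [← hd]
    have e1 : (x₀ + c) / 2 - (a + x₀) / 2 = (c - a) / 2 := by ring
    rw [e1]
    have hu : U / 2 ≤ (t - α) * (β - t) := by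
      have q1 : 0 ≤ x₀ - α := by linarith [hx₀.1]
      have q2 : 0 ≤ β - x₀ := by linarith [hx₀.2]
      rcases le_total t x₀ with hle | hle
      · calc U / 2 = ((x₀ - α) / 2) * (β - x₀) := by rw [hUdef]; ring
          _ ≤ _ := mul_le_mul (by linarith [ht.1]) (by linarith) q2
            (by linarith [(hsub (hsub3 ht)).1])
      · calc U / 2 = (x₀ - α) * ((β - x₀) / 2) := by rw [hUdef]; ring
          _ ≤ _ := mul_le_mul (by linarith) (by linarith [ht.2]) (by linarith)
            (by linarith [(hsub (hsub3 ht)).1])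
    have hg : G b / E ≤ G t := by
      rw [div_le_iff₀ hE0, mul_comm]
      exact hcomp b bmem t (hsub (hsub3 ht))
    have : 0 ≤ (c - a) / 2 := by linarith
    have : 0 ≤ ((t - α) * (β - t)) ^ p := Real.rpow_nonneg (by linarith) _
    gcongr
  have hca : 0 ≤ c - a := by linarith
  have hba : 0 ≤ b - a := by linarith
  have hEE : Real.exp (2 * C * (β - α)) = E * E := by
    rw [hE, ← Real.exp_add]; congr 1; ring
  rw [hEE, Real.rpow_add_one (by norm_num)]
  calc (c - a) * (F b - F a) ≤ (c - a) * (U ^ p * (E * G b) * (b - a)) := by gcongr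
    _ = (2 ^ p * 2 * (E * E)) * ((b - a) * ((U / 2) ^ p * (G b / E) * ((c - a) / 2))) := by
      rw [Real.div_rpow hU.le (by norm_num)]
      field_simp
    _ ≤ _ := by gcongr

/-- The bound of `slope_le_const` for segments that may begin in or before a flat interval. -/
theorem slope_le_const_of_flat (h : HasPowerLawDeriv F G α β p C) (hF : Monotone F)
    (hcont : Continuous F) {κ : ℝ} (hκ : 0 < κ) (hflat : ∀ x ∈ Icc (α - κ) α, F x = F α)
    {a b c : ℝ} (hab : a < b) (hbc : b < c) (hb : α < b) (hcβ : c < β) (hca : c - a ≤ 1) :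
    (c - a) * (F b - F a) ≤
      (2 ^ (p + 1) * Real.exp (2 * C * (β - α)) + 1 / κ) * ((b - a) * (F c - F a)) := by
  have hFab := hF hab.le
  have hFbc := hF hbc.le
  have nn : 0 ≤ (b - a) * (F c - F a) := mul_nonneg (by linarith) (by linarith)
  rcases le_or_gt α a with ha | ha
  · have := h.slope_le_const hcont.continuousOn ha hab hbc hcβ
    have h2 : 0 ≤ 1 / κ * ((b - a) * (F c - F a)) := mul_nonneg (by positivity) nn
    linarith
  rcases le_or_gt (α - κ) a with ha2 | ha2
  · have hFa : F a = F α := hflat a ⟨ha2, ha.le⟩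
    have := h.slope_le_const hcont.continuousOn le_rfl hb hbc hcβ
    have h2 : 0 ≤ 1 / κ * ((b - a) * (F c - F a)) := mul_nonneg (by positivity) nn
    rw [← hFa] at this
    -- As `F` is constant on `[a, α]`, moving `a` to `α` leaves the increments alone and can only
    -- increase `(c - a) / (b - a)`.
    have h3 : (c - a) * (F b - F a) * (b - α) ≤ (b - a) * ((c - α) * (F b - F a)) := by
      have : (c - a) * (b - α) ≤ (b - a) * (c - α) := by nlinarith
      nlinarith
    have h4 : (c - a) * (F b - F a) * (b - α) ≤
        (2 ^ (p + 1) * Real.exp (2 * C * (β - α))) * ((b - a) * (F c - F a)) * (b - α) := by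
      have h5 := mul_le_mul_of_nonneg_left this (show 0 ≤ b - a by linarith)
      linarith
    have := le_of_mul_le_mul_right h4 (by linarith)
    linarith
  -- Here `[a, b]` contains the whole flat piece, so `b - a ≥ κ`.
  · have h1 : (c - a) * (F b - F a) ≤ 1 * (F c - F a) :=
      mul_le_mul hca (by linarith) (by linarith) zero_le_one
    have h2 : 1 * (F c - F a) ≤ 1 / κ * ((b - a) * (F c - F a)) := by
      rw [← mul_assoc]
      refine mul_le_mul_of_nonneg_right ?_ (by linarith)
      rw [one_div, inv_mul_eq_div, le_div_iff₀ hκ]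
      linarith
    have h3 : 0 ≤ (2 ^ (p + 1) * Real.exp (2 * C * (β - α))) * ((b - a) * (F c - F a)) :=
      mul_nonneg (by positivity) nn
    linarith

/-- Cross-ratios are distorted by a bounded amount when only the middle interval avoids the flat
part. -/
theorem crossRatio_le_const (h : HasPowerLawDeriv F G α β p C) (hF : Monotone F)
    (hcont : Continuous F) {κ : ℝ} (hκ : 0 < κ) (hα : ∀ x ∈ Icc (α - κ) α, F x = F α)
    (hβ : ∀ x ∈ Icc β (β + κ), F x = F β) {a b c d : ℝ} (hab : a < b) (hbc : b < c) (hcd : c < d)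
    (hb : α < b) (hc : c < β) (hda : d - a ≤ 1) :
    ((c - a) * (d - b)) * ((F b - F a) * (F d - F c)) ≤
      (2 ^ (p + 1) * Real.exp (2 * C * (β - α)) + 1 / κ) ^ 2 *
        (((b - a) * (d - c)) * ((F c - F a) * (F d - F b))) := by
  have h1 := h.slope_le_const_of_flat hF hcont hκ hα hab hbc hb hc (by linarith)
  have h2 := h.mirror.slope_le_const_of_flat
    (fun x y hxy => neg_le_neg (hF (neg_le_neg hxy))) (by fun_prop) hκ
    (fun x hx => by
      simp only [neg_neg]
      rw [hβ (-x) ⟨by linarith [hx.2], by linarith [hx.1]⟩])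
    (neg_lt_neg hcd) (neg_lt_neg hbc) (neg_lt_neg hc) (neg_lt_neg hb) (by linarith)
  simp only [neg_neg, sub_neg_eq_add] at h2
  have e : -α + β = β - α := by ring
  rw [e] at h2
  set K := 2 ^ (p + 1) * Real.exp (2 * C * (β - α)) + 1 / κ
  have hK : 0 ≤ K := by positivity
  have m1 := hF hab.le
  have m2 := hF hbc.le
  have m3 := hF hcd.le
  have h3 := mul_le_mul h1 h2 (mul_nonneg (by linarith) (by linarith))
    (mul_nonneg hK (mul_nonneg (by linarith) (by linarith)))
  linarith

end HasPowerLawDeriv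

/-! ### From the germs at the end points to the power law -/

/-- A `C¹` function on `(α, β)` that has `C¹` extensions across both end points is Lipschitz. -/
theorem exists_lipschitz_of_contDiffAt {φ ψ χ : ℝ → ℝ} {α β : ℝ} (hαβ : α < β)
    (h : ∀ x ∈ Ioo α β, ContDiffAt ℝ 1 φ x) (hψ : ContDiffAt ℝ 1 ψ α)
    (hφψ : ∀ᶠ x in 𝓝[>] α, φ x = ψ x) (hχ : ContDiffAt ℝ 1 χ β)
    (hφχ : ∀ᶠ x in 𝓝[<] β, φ x = χ x) :
    ∃ K : ℝ, 0 ≤ K ∧ ∀ x ∈ Ioo α β, ∀ y ∈ Ioo α β, φ x - φ y ≤ K * |x - y| := by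
  classical
  -- With the values of the two extensions at the end points, the function is locally Lipschitz on
  -- the compact interval `[α, β]`, hence Lipschitz.
  set φ' : ℝ → ℝ := Function.update (Function.update φ α (ψ α)) β (χ β) with hφ'
  have e0 : ∀ x ∈ Ioo α β, φ' x = φ x := fun x hx => by
    rw [hφ', Function.update_of_ne hx.2.ne, Function.update_of_ne hx.1.ne']
  have hloc : LocallyLipschitzOn (Icc α β) φ' := by
    intro x hx
    have glue : ∀ {g : ℝ → ℝ}, ContDiffAt ℝ 1 g x → (∀ᶠ y in 𝓝[Icc α β] x, φ' y = g y) →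
        ∃ K : NNReal, ∃ t ∈ 𝓝[Icc α β] x, LipschitzOnWith K φ' t := by
      intro g hg heq
      obtain ⟨K, t, ht, hK⟩ := hg.exists_lipschitzOnWith
      refine ⟨K, t ∩ {y | φ' y = g y}, inter_mem (mem_nhdsWithin_of_mem_nhds ht) heq, ?_⟩
      intro y hy z hz
      rw [hy.2, hz.2]
      exact hK hy.1 hz.1
    rcases hx.1.eq_or_lt with rfl | hx1
    · refine glue hψ ?_
      have h1 : ∀ᶠ y in 𝓝[≥] α, φ' y = ψ y := by
        rw [← Ioi_insert, nhdsWithin_insert, eventually_sup]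
        refine ⟨?_, ?_⟩
        · rw [eventually_pure, hφ', Function.update_of_ne hαβ.ne, Function.update_self]
        · filter_upwards [hφψ, Ioo_mem_nhdsGT hαβ] with y hy hy2
          rw [e0 y hy2, hy]
      exact nhdsWithin_mono _ Icc_subset_Ici_self h1
    rcases hx.2.eq_or_lt with rfl | hx2
    · refine glue hχ ?_
      have h1 : ∀ᶠ y in 𝓝[≤] x, φ' y = χ y := by
        rw [← Iio_insert, nhdsWithin_insert, eventually_sup]
        refine ⟨?_, ?_⟩
        · rw [eventually_pure, hφ', Function.update_self]
        · filter_upwards [hφχ, Ioo_mem_nhdsLT hαβ] with y hy hy2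
          rw [e0 y hy2, hy]
      exact nhdsWithin_mono _ Icc_subset_Iic_self h1
    · refine glue (h x ⟨hx1, hx2⟩) (mem_nhdsWithin_of_mem_nhds ?_)
      filter_upwards [Ioo_mem_nhds hx1 hx2] with y hy using e0 y hy
  obtain ⟨K, hK⟩ := hloc.exists_lipschitzOnWith_of_compact isCompact_Icc
  refine ⟨K, K.2, fun x hx y hy => ?_⟩
  have := hK.dist_le_mul x (Ioo_subset_Icc_self hx) y (Ioo_subset_Icc_self hy)
  rw [Real.dist_eq, Real.dist_eq, e0 x hx, e0 y hy] at this
  exact (le_abs_self _).trans this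

theorem ContDiffAt.deriv_of_two {F : ℝ → ℝ} {x : ℝ} (h : ContDiffAt ℝ 2 F x) :
    ContDiffAt ℝ 1 (deriv F) x :=
  ((h.fderiv_right (m := 1) (by norm_num)).clm_apply contDiffAt_const :)

theorem IsLocalDiffeomorphAt.contDiffAt_and_deriv_ne_zero {h : ℝ → ℝ} {x : ℝ}
    (hh : IsLocalDiffeomorphAt 𝓘(ℝ, ℝ) 𝓘(ℝ, ℝ) 2 h x) :
    ContDiffAt ℝ 2 h x ∧ deriv h x ≠ 0 := by
  refine ⟨hh.contMDiffAt.contDiffAt, fun h0 => ?_⟩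
  have e := hh.mfderivToContinuousLinearEquiv_coe two_ne_zero
  rw [mfderiv_eq_fderiv] at e
  have h1 : hh.mfderivToContinuousLinearEquiv two_ne_zero (1 : ℝ) = (0 : ℝ) := by
    have := congrArg (fun L : ℝ →L[ℝ] ℝ => L 1) e
    refine this.trans ?_
    exact h0
  have h2 : (1 : ℝ) = 0 := (hh.mfderivToContinuousLinearEquiv two_ne_zero).map_eq_zero_iff.1 h1
  exact one_ne_zero h2

/-- A power law germ `x ↦ h ((x - b) ^ ℓ)` with vanishing derivative at `b`: the exponent is at
least `1`, and the logarithm of the derivative is `(ℓ - 1) log (x - b)` up to a `C¹` function. -/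
theorem powerLaw_germ {F h : ℝ → ℝ} {b l : ℝ} (hl : 0 < l) (hF : HasDerivAt F 0 b)
    (hh : ContDiffAt ℝ 2 h 0) (hh0 : deriv h 0 ≠ 0)
    (hgerm : ∀ᶠ x in 𝓝[>] b, F x = h ((x - b) ^ l)) :
    1 ≤ l ∧ ∃ ψ : ℝ → ℝ, ContDiffAt ℝ 1 ψ b ∧
      ∀ᶠ x in 𝓝[>] b, Real.log (deriv F x) - (l - 1) * Real.log (x - b) = ψ x := by
  have hd : HasDerivAt h (deriv h 0) 0 :=
    (hh.differentiableAt (by norm_num)).hasDerivAt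
  have hpow : Tendsto (fun x => (x - b) ^ l) (𝓝[>] b) (𝓝[≠] 0) := by
    refine tendsto_nhdsWithin_iff.2 ⟨?_, ?_⟩
    · have : Tendsto (fun x => (x - b) ^ l) (𝓝 b) (𝓝 ((b - b) ^ l)) :=
        ((continuous_id.sub continuous_const).rpow_const (fun _ => Or.inr hl.le)).tendsto b
      rw [sub_self, Real.zero_rpow hl.ne'] at this
      exact this.mono_left nhdsWithin_le_nhds
    · filter_upwards [self_mem_nhdsWithin] with x hx
      exact (Real.rpow_pos_of_pos (sub_pos.2 hx) l).ne'
  have h1l : 1 ≤ l := by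
    -- For `l < 1` one has `x - b ≤ (x - b) ^ l` near `b`, so the slopes of `F` dominate those of
    -- `h`, which tend to `deriv h 0 ≠ 0`; but the slopes of `F` tend to `0`.
    by_contra! hlt
    have hFb : F b = h 0 := by
      have t1 : Tendsto F (𝓝[>] b) (𝓝 (F b)) := hF.continuousAt.tendsto.mono_left nhdsWithin_le_nhds
      have t2 : Tendsto (fun x => h ((x - b) ^ l)) (𝓝[>] b) (𝓝 (h 0)) :=
        hd.continuousAt.tendsto.comp (hpow.mono_right nhdsWithin_le_nhds)
      exact tendsto_nhds_unique (t1.congr' hgerm) t2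
    have s1 : Tendsto (slope F b) (𝓝[>] b) (𝓝 0) :=
      (hasDerivAt_iff_tendsto_slope.1 hF).mono_left
        (nhdsWithin_mono _ fun x hx => (mem_Ioi.1 hx).ne')
    have s2 : Tendsto (fun x => slope h 0 ((x - b) ^ l)) (𝓝[>] b) (𝓝 (deriv h 0)) :=
      (hasDerivAt_iff_tendsto_slope.1 hd).comp hpow
    have hle : ∀ᶠ x in 𝓝[>] b, |slope h 0 ((x - b) ^ l)| ≤ |slope F b x| := by
      filter_upwards [hgerm, Ioo_mem_nhdsGT (show b < b + 1 by linarith)] with x hx hx1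
      have hs : 0 < x - b := sub_pos.2 hx1.1
      rw [slope_def_field, slope_def_field, hx, hFb, sub_zero, abs_div, abs_div]
      have hle : x - b ≤ (x - b) ^ l := by
        have := Real.rpow_le_rpow_of_exponent_ge hs (by linarith [hx1.2]) hlt.le
        rwa [Real.rpow_one] at this
      rw [abs_of_pos hs, abs_of_pos (Real.rpow_pos_of_pos hs l)]
      gcongr
    have := le_of_tendsto_of_tendsto s2.abs s1.abs hle
    rw [abs_zero] at this
    exact hh0 (abs_nonpos_iff.1 this)
  -- The chain rule gives `F' = h' ((x - b) ^ l) * l * (x - b) ^ (l - 1)`. The first factor is `C¹`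
  -- up to `b` because `h` is `C²` and `1 ≤ l`.
  refine ⟨h1l, fun x => Real.log (deriv h ((x - b) ^ l)) + Real.log l, ?_, ?_⟩
  · have c1 : ContDiffAt ℝ 1 (fun x : ℝ => (x - b) ^ l) b :=
      ((Real.contDiff_rpow_const_of_le (n := 1) (by simpa using h1l)).contDiffAt).comp b
        (contDiffAt_id.sub contDiffAt_const)
    have e : (b - b) ^ l = 0 := by rw [sub_self, Real.zero_rpow hl.ne']
    have c2 : ContDiffAt ℝ 1 (fun x : ℝ => deriv h ((x - b) ^ l)) b :=
      ContDiffAt.comp (g := deriv h) b (by rw [e]; exact hh.deriv_of_two) c1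
    refine (c2.log ?_).add contDiffAt_const
    rwa [e]
  · have hdiff : ∀ᶠ y in 𝓝 (0 : ℝ), DifferentiableAt ℝ h y := by
      filter_upwards [hh.eventually (by norm_num)] with y hy
      exact hy.differentiableAt (by norm_num)
    have hne : ∀ᶠ y in 𝓝 (0 : ℝ), deriv h y ≠ 0 :=
      hh.deriv_of_two.continuousAt.eventually_ne hh0
    have hp' := hpow.mono_right nhdsWithin_le_nhds
    filter_upwards [eventually_eventually_nhdsWithin.2 hgerm, self_mem_nhdsWithin,
      hp'.eventually hdiff, hp'.eventually hne] with x hx hxb hdx hnx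
    have hs : 0 < x - b := sub_pos.2 hxb
    have heq : F =ᶠ[𝓝 x] fun y => h ((y - b) ^ l) := by
      rw [isOpen_Ioi.nhdsWithin_eq hxb] at hx
      exact hx
    have hder : HasDerivAt (fun y => h ((y - b) ^ l))
        (deriv h ((x - b) ^ l) * (1 * l * (x - b) ^ (l - 1))) x :=
      HasDerivAt.comp x hdx.hasDerivAt
        (((hasDerivAt_id x).sub_const b).rpow_const (Or.inl hs.ne'))
    have hpp := Real.rpow_pos_of_pos hs (l - 1)
    rw [heq.deriv_eq, hder.deriv, one_mul, Real.log_mul hnx (mul_pos hl hpp).ne',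
      Real.log_mul hl.ne' hpp.ne', Real.log_rpow hs]
    ring

namespace FlatCircleMap

variable (f : FlatCircleMap)

theorem contDiffAt_of_mem {x : ℝ} (hx : x ∈ Ioo f.b (f.a + 1)) : ContDiffAt ℝ 2 f.lift x := by
  have ne : ∀ c : ℝ, c < x → x < c + 1 → (x : UnitAddCircle) ≠ (c : UnitAddCircle) := by
    intro c h1 h2 h
    obtain ⟨n, hn⟩ := (AddCircle.coe_eq_coe_iff_of_mem_Ico (p := (1 : ℝ)) (a := c)
      ⟨h1.le, h2⟩ ⟨le_rfl, by linarith⟩).1 h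
    exact lt_irrefl _ h1
  exact f.contDiffAt x (ne _ (f.a_lt_b.trans hx.1) hx.2)
    (ne _ hx.1 (hx.2.trans (by linarith [f.a_lt_b])))

/-- With `p = ℓ - 1`, subtracting `p` times the logarithms of the distances to both ends from `log
F'` leaves a function that extends as `C¹` across each end, hence a Lipschitz one. `G` is its
exponential. -/
theorem exists_hasPowerLawDeriv :
    ∃ G p C, HasPowerLawDeriv f.lift G f.b (f.a + 1) p C := by
  have hab := f.a_lt_b
  have hba := f.b_lt_a_add_one
  have per : ∀ x, f.lift x = f.lift (x - 1) + 1 := fun x => by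
    rw [← f.lift.map_add_one, sub_add_cancel]
  -- right germ
  obtain ⟨h, hh, hgerm⟩ := f.right_germ
  obtain ⟨h2, hne⟩ := hh.contDiffAt_and_deriv_ne_zero
  obtain ⟨hl, ψ, hψ, hψe⟩ := powerLaw_germ f.exponent_pos
    (f.hasDerivAt_zero f.b ⟨hab.le, le_rfl⟩) h2 hne hgerm
  -- left germ
  obtain ⟨k, hk, kgerm⟩ := f.left_germ
  obtain ⟨k2, kne⟩ := hk.contDiffAt_and_deriv_ne_zero
  have tneg : Tendsto (fun x : ℝ => -x) (𝓝[>] (-(f.a + 1))) (𝓝[<] (f.a + 1)) :=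
    tendsto_neg_nhdsGT_neg
  have tneg' : Tendsto (fun x : ℝ => -x) (𝓝[<] (f.a + 1)) (𝓝[>] (-(f.a + 1))) :=
    tendsto_neg_nhdsLT
  have tsub : Tendsto (fun x : ℝ => x - 1) (𝓝[<] (f.a + 1)) (𝓝[<] f.a) := by
    refine tendsto_nhdsWithin_iff.2 ⟨?_, ?_⟩
    · have : Tendsto (fun x : ℝ => x - 1) (𝓝 (f.a + 1)) (𝓝 (f.a + 1 - 1)) :=
        (continuous_id.sub continuous_const).tendsto _
      rw [add_sub_cancel_right] at this
      exact this.mono_left nhdsWithin_le_nhds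
    · filter_upwards [self_mem_nhdsWithin] with x hx
      exact sub_lt_iff_lt_add.2 (mem_Iio.1 hx)
  -- The left germ at `a`, moved to `a + 1` by periodicity, becomes a right germ under `x ↦ -F
  -- (-x)`.
  obtain ⟨-, χ, hχ, hχe⟩ := powerLaw_germ (F := fun x => -f.lift (-x)) (b := -(f.a + 1))
    (h := fun y => -(k y + 1)) f.exponent_pos
    (by
      have : HasDerivAt f.lift 0 (- -(f.a + 1)) := by
        rw [neg_neg]
        have h0 := f.hasDerivAt_zero f.a ⟨le_rfl, hab.le⟩
        have e : (f.lift : ℝ → ℝ) = fun x => f.lift (x - 1) + 1 := funext per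
        rw [e]
        rw [← add_sub_cancel_right f.a 1] at h0
        exact (h0.comp_sub_const (f.a + 1) 1).add_const 1
      exact this.neg_comp_neg)
    (k2.add contDiffAt_const).neg
    (by
      rw [deriv.fun_neg, deriv_add_const]
      exact neg_ne_zero.2 kne)
    (by
      filter_upwards [tneg.eventually (tsub.eventually kgerm)] with x hx
      rw [per (-x), hx]
      ring_nf)
  set p := f.exponent - 1 with hp
  have hχe' := tneg'.eventually hχe
  -- the logarithm of the regular factor
  set φ : ℝ → ℝ := fun x => Real.log (deriv f.lift x) - p * Real.log (x - f.b)
    - p * Real.log (f.a + 1 - x) with hφ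
  obtain ⟨C, hC, hlip⟩ := exists_lipschitz_of_contDiffAt (φ := φ)
    (ψ := fun x => ψ x - p * Real.log (f.a + 1 - x))
    (χ := fun x => χ (-x) - p * Real.log (x - f.b)) hba
    (by
      intro x hx
      refine ((f.contDiffAt_of_mem hx).deriv_of_two.log (f.deriv_pos x hx).ne').sub
        (contDiffAt_const.mul (ContDiffAt.log (by fun_prop) (sub_pos.2 hx.1).ne')) |>.sub
        (contDiffAt_const.mul (ContDiffAt.log (by fun_prop) (sub_pos.2 hx.2).ne')))
    (hψ.sub (contDiffAt_const.mul (ContDiffAt.log (by fun_prop) (sub_pos.2 hba).ne')))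
    (by filter_upwards [hψe] with x hx; rw [← hx])
    (ContDiffAt.sub (ContDiffAt.comp _ hχ contDiffAt_id.neg)
      (contDiffAt_const.mul (ContDiffAt.log (by fun_prop) (sub_pos.2 hba).ne')))
    (by
      filter_upwards [hχe'] with x hx
      rw [← hx, deriv.fun_neg, deriv_comp_neg, neg_neg, hφ, sub_neg_eq_add, neg_add_eq_sub]
      ring_nf)
  refine ⟨fun x => Real.exp (φ x), p, C, by linarith, hC, fun x hx => ?_,
    fun x _ => Real.exp_pos _, fun x hx y hy => ?_⟩
  · have hd := f.deriv_pos x hx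
    refine ((f.contDiffAt_of_mem hx).differentiableAt (by norm_num)).hasDerivAt.congr_deriv ?_
    have h1 : 0 < x - f.b := sub_pos.2 hx.1
    have h2 : 0 < f.a + 1 - x := sub_pos.2 hx.2
    rw [Real.rpow_def_of_pos (mul_pos h1 h2), ← Real.exp_add, Real.log_mul h1.ne' h2.ne', hφ]
    conv_lhs => rw [← Real.exp_log hd]
    congr 1
    ring
  · rw [← Real.exp_add, Real.exp_le_exp]
    linarith [hlip x hx y hy]

theorem lift_eq_of_mem_Icc {x : ℝ} (hx : x ∈ Icc f.a f.b) : f.lift x = f.lift f.b := by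
  refine (convex_Icc f.a f.b).is_const_of_fderivWithin_eq_zero (𝕜 := ℝ)
    (fun y hy => (f.hasDerivAt_zero y hy).differentiableAt.differentiableWithinAt) ?_ hx
    ⟨f.a_lt_b.le, le_rfl⟩
  intro y hy
  have := (f.hasDerivAt_zero y hy).hasFDerivAt.hasFDerivWithinAt (s := Icc f.a f.b)
  rw [this.fderivWithin (uniqueDiffOn_Icc f.a_lt_b y hy)]
  simp

end FlatCircleMap

/-! ### Semiconjugacy to a translation -/

namespace CircleDeg1Lift

variable (F : CircleDeg1Lift)

theorem surjective_of_continuous (hF : Continuous F) : Function.Surjective F :=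
  hF.surjective F.tendsto_atTop F.tendsto_atBot

/-- Together with `sub_one_lt_iterate` this keeps `F^n x - n τ` within `1` of `x`, so that its upper
limit is finite. -/
theorem iterate_lt_add (x : ℝ) (n : ℕ) : F^[n] x < x + n * F.translationNumber + 1 := by
  have := (F ^ n).map_lt_add_translationNumber_add_one x
  rwa [translationNumber_pow, coe_pow] at this

theorem sub_one_lt_iterate (x : ℝ) (n : ℕ) : x + n * F.translationNumber - 1 < F^[n] x := by
  have := (F ^ n).lt_map_of_int_lt_translationNumber
    (n := ⌈(F ^ n).translationNumber⌉ - 1) (by push_cast; linarith [Int.ceil_lt_add_one (F ^ n).translationNumber]) x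
  rw [translationNumber_pow, coe_pow] at this
  push_cast at this
  linarith [Int.le_ceil (n * F.translationNumber)]

/-- A continuous lift with irrational translation number is semiconjugate to a translation by a
continuous monotone degree one map. -/
theorem exists_semiconj_translation (hF : Continuous F) (hirr : Irrational F.translationNumber) :
    ∃ H : CircleDeg1Lift, Continuous H ∧ ∀ x, H (F x) = H x + F.translationNumber := by
  set τ := F.translationNumber with hτ
  -- `H x` is the upper limit of this sequence. Replacing `x` by `F x` shifts the index by one and
  -- adds `τ`.
  set s : ℝ → ℕ → ℝ := fun x n => F^[n] x - n * τ with hs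
  have ub : ∀ x n, s x n ≤ x + 1 := fun x n => by
    have := F.iterate_lt_add x n
    simp only [hs]; linarith
  have lb : ∀ x n, x - 1 ≤ s x n := fun x n => by
    have := F.sub_one_lt_iterate x n
    simp only [hs]; linarith
  have bdd : ∀ x, IsBoundedUnder (· ≤ ·) atTop (s x) := fun x =>
    isBoundedUnder_of ⟨x + 1, ub x⟩
  have bdd' : ∀ x, IsBoundedUnder (· ≥ ·) atTop (s x) := fun x =>
    isBoundedUnder_of ⟨x - 1, lb x⟩
  have add_const : ∀ x c, limsup (fun n => s x n + c) atTop = limsup (s x) atTop + c := fun x c =>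
    limsup_add_const atTop (s x) c (bdd x) (bdd' x).isCobounded_le
  set H : CircleDeg1Lift := ⟨⟨fun x => limsup (s x) atTop, fun x y hxy => by
    refine limsup_le_limsup (Eventually.of_forall fun n => ?_) (bdd' x).isCobounded_le (bdd y)
    exact sub_le_sub_right (F.monotone.iterate n hxy) _⟩, fun x => by
      change limsup (s (x + 1)) atTop = limsup (s x) atTop + 1
      rw [← add_const]
      congr 1
      ext n
      have := (F ^ n).map_add_one x
      rw [coe_pow] at this
      simp only [hs, this]
      ring⟩ with hH
  have hHF : ∀ x, H (F x) = H x + τ := by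
    intro x
    change limsup (s (F x)) atTop = limsup (s x) atTop + τ
    rw [← add_const, ← limsup_nat_add (fun n => s x n + τ) 1]
    congr 1
    ext n
    simp only [hs, Function.iterate_succ_apply]
    push_cast
    ring
  -- A monotone function with dense range has no jumps.
  refine ⟨H, H.monotone.continuous_of_denseRange ?_, hHF⟩
  -- the range of `H` contains a translate of the dense group generated by `τ` and `1`
  have hd : Dense (AddSubgroup.closure {τ, 1} : Set ℝ) :=
    dense_addSubgroupClosure_pair_iff.2 (by simpa using hirr)
  have hsub : ∀ g ∈ AddSubgroup.closure {τ, (1 : ℝ)}, ∀ y, y + g ∈ range H ↔ y ∈ range H := by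
    intro g hg
    induction hg using AddSubgroup.closure_induction with
    | mem x hx =>
      intro y
      rcases hx with rfl | rfl
      · refine ⟨?_, ?_⟩
        · rintro ⟨z, hz⟩
          obtain ⟨w, rfl⟩ := F.surjective_of_continuous hF z
          exact ⟨w, by linarith [hHF w]⟩
        · rintro ⟨z, rfl⟩
          exact ⟨F z, hHF z⟩
      · refine ⟨?_, ?_⟩
        · rintro ⟨z, hz⟩
          refine ⟨z - 1, ?_⟩
          have := H.map_add_one (z - 1)
          rw [sub_add_cancel] at this
          linarith
        · rintro ⟨z, rfl⟩
          exact ⟨z + 1, H.map_add_one z⟩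
    | zero => intro y; rw [add_zero]
    | add x y _ _ hx hy =>
      intro z
      rw [← add_assoc, hy, hx]
    | neg x _ hx =>
      intro y
      rw [← hx, neg_add_cancel_right]
  refine ((Homeomorph.addLeft (H 0)).surjective.denseRange.dense_image
    (Homeomorph.addLeft (H 0)).continuous hd).mono ?_
  rintro _ ⟨g, hg, rfl⟩
  exact (hsub g hg _).2 ⟨0, rfl⟩

end CircleDeg1Lift

/-! ### Return times of the rotation, and counting -/

/-- Record return times of an irrational rotation. -/
theorem Irrational.exists_record {ρ : ℝ} (hρ : Irrational ρ) {ε : ℝ} (hε : 0 < ε) :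
    ∃ (N k : ℕ) (p q : ℤ), 0 < k ∧ k < N ∧ 0 < |k * ρ - p| ∧ |k * ρ - p| < ε ∧
      (∀ j : ℕ, 0 < j → j < N → ∀ m : ℤ, |k * ρ - p| ≤ |j * ρ - m|) ∧
      |N * ρ - q| < |k * ρ - p| := by
  classical
  have small : ∀ ε : ℝ, 0 < ε → ∃ k : ℕ, 0 < k ∧ ∃ m : ℤ, |k * ρ - m| < ε := by
    intro ε hε
    obtain ⟨n, hn⟩ := exists_nat_one_div_lt hε
    obtain ⟨k, hk, -, h⟩ := Real.exists_nat_abs_mul_sub_round_le ρ n.succ_pos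
    refine ⟨k, hk, _, h.trans_lt (lt_of_le_of_lt ?_ hn)⟩
    gcongr
    linarith
  have pos : ∀ k : ℕ, 0 < k → ∀ m : ℤ, 0 < |k * ρ - m| := fun k hk m =>
    abs_pos.2 (sub_ne_zero.2 ((hρ.natCast_mul hk.ne').ne_int m))
  -- `k` is the first return closer than `ε`, and `N` below is the first return closer than that of
  -- `k`; the minimality of `N` makes `k` the closest return before `N`.
  set k := Nat.find (small ε hε) with hk
  obtain ⟨hk0, m₀, hm₀⟩ := Nat.find_spec (small ε hε)
  rw [← hk] at hk0 hm₀
  set p := round (k * ρ)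
  have hp : |k * ρ - p| < ε := (round_le _ m₀).trans_lt hm₀
  set N := Nat.find (small _ (pos k hk0 p)) with hN
  obtain ⟨hN0, q, hq⟩ := Nat.find_spec (small _ (pos k hk0 p))
  rw [← hN] at hN0 hq
  refine ⟨N, k, p, q, hk0, ?_, pos k hk0 p, hp, fun j hj0 hjN m => ?_, hq⟩
  · by_contra! hle
    rcases hle.lt_or_eq with hlt | heq
    · exact Nat.find_min (small ε hε) hlt ⟨hN0, q, hq.trans hp⟩
    · rw [heq] at hq
      exact absurd (round_le (k * ρ) q) (not_le.2 hq)
  · by_contra! hlt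
    exact Nat.find_min (small _ (pos k hk0 p)) hjN ⟨hj0, m, hlt⟩

/-- Points of an orbit segment of record length have neighbours on both sides at most two minimal
distances away. -/
theorem exists_orbit_neighbours {ρ : ℝ} {N k : ℕ} {p q : ℤ} (hkN : k < N)
    (h0 : 0 < |k * ρ - p|) (hN : |N * ρ - q| < |k * ρ - p|) {i : ℕ} (hi : i < N) :
    (∃ l < N, ∃ m : ℤ, 0 < (l - i) * ρ + m ∧ (l - i) * ρ + m < 2 * |k * ρ - p|) ∧
      ∃ l < N, ∃ m : ℤ, (l - i) * ρ + m < 0 ∧ -(2 * |k * ρ - p|) < (l - i) * ρ + m := by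
  -- Moving `k` steps along the orbit displaces by `x`. If this leaves the segment, correcting by
  -- `N` steps changes the displacement by less than `|x|`, so it keeps its sign and stays below `2
  -- |x|` in size.
  set x := k * ρ - p with hx
  have fwd : ∃ l < N, ∃ m : ℤ, |(l - i) * ρ + m - x| < |x| := by
    by_cases h : i + k < N
    · refine ⟨i + k, h, -p, ?_⟩
      push_cast
      have : ((i : ℝ) + k - i) * ρ + -p - x = 0 := by rw [hx]; ring
      rwa [this, abs_zero]
    · refine ⟨i + k - N, by omega, q - p, ?_⟩
      rw [Nat.cast_sub (by omega)]
      push_cast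
      have : ((i : ℝ) + k - N - i) * ρ + (q - p) - x = -(N * ρ - q) := by rw [hx]; ring
      rwa [this, abs_neg]
  have bwd : ∃ l < N, ∃ m : ℤ, |(l - i) * ρ + m + x| < |x| := by
    by_cases h : k ≤ i
    · refine ⟨i - k, by omega, p, ?_⟩
      rw [Nat.cast_sub h]
      have : ((i : ℝ) - k - i) * ρ + p + x = 0 := by rw [hx]; ring
      rwa [this, abs_zero]
    · refine ⟨i + N - k, by omega, p - q, ?_⟩
      rw [Nat.cast_sub (by omega)]
      push_cast
      have : ((i : ℝ) + N - k - i) * ρ + (p - q) + x = N * ρ - q := by rw [hx]; ring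
      rwa [this]
  obtain ⟨l, hl, m, hm⟩ := fwd
  obtain ⟨l', hl', m', hm'⟩ := bwd
  rw [abs_lt] at hm hm'
  rcases abs_cases x with ⟨h, h'⟩ | ⟨h, h'⟩ <;> rw [h] at hm hm' ⊢
  · exact ⟨⟨l, hl, m, by linarith, by linarith⟩, ⟨l', hl', m', by linarith, by linarith⟩⟩
  · exact ⟨⟨l', hl', m', by linarith, by linarith⟩, ⟨l, hl, m, by linarith, by linarith⟩⟩

/-- At most five `δ`-separated real numbers lie within `2 δ` of a given one. -/
theorem card_le_five_of_separated {ι : Type*} {S : Finset ι} {t : ι → ℝ} {δ p : ℝ} (hδ : 0 < δ)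
    (hsep : ∀ i ∈ S, ∀ j ∈ S, i ≠ j → δ ≤ |t i - t j|) (hnear : ∀ i ∈ S, |t i - p| ≤ 2 * δ) :
    S.card ≤ 5 := by
  have h : S.card ≤ (Finset.Icc (-2 : ℤ) 2).card := by
    refine Finset.card_le_card_of_injOn (fun i => ⌊(t i - p) / δ⌋) (fun i hi => ?_) ?_
    · have := abs_le.1 (hnear i hi)
      rw [Finset.coe_Icc, mem_Icc]
      constructor
      · rw [Int.le_floor, le_div_iff₀ hδ]
        push_cast
        linarith
      · rw [← Int.lt_add_one_iff, Int.floor_lt, div_lt_iff₀ hδ]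
        push_cast
        linarith
    · intro i hi j hj hij
      by_contra hne
      have h1 := Int.abs_sub_lt_one_of_floor_eq_floor hij
      have h2 := hsep i hi j hj hne
      rw [← sub_div, sub_sub_sub_cancel_right, abs_div, abs_of_pos hδ, div_lt_one hδ] at h1
      linarith
  simpa using h

/-- The total length of intervals in `[0, L]` that cover no point more than `k` times. -/
theorem sum_length_le_of_multiplicity {ι : Type*} (S : Finset ι) (a b : ι → ℝ) (k : ℕ) {L : ℝ}
    (hL : 0 ≤ L) (h0 : ∀ i ∈ S, 0 ≤ a i) (h1 : ∀ i ∈ S, b i ≤ L) (hab : ∀ i ∈ S, a i ≤ b i)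
    (hk : ∀ x, ∀ T ⊆ S, (∀ i ∈ T, x ∈ Ioo (a i) (b i)) → T.card ≤ k) :
    ∑ i ∈ S, (b i - a i) ≤ k * L := by
  classical
  have hvol : ∀ i ∈ S, ∫⁻ x in Ioo 0 L, (Ioo (a i) (b i)).indicator 1 x =
      ENNReal.ofReal (b i - a i) := by
    intro i hi
    rw [MeasureTheory.lintegral_indicator_one measurableSet_Ioo,
      MeasureTheory.Measure.restrict_apply measurableSet_Ioo,
      inter_eq_left.2 (Ioo_subset_Ioo (h0 i hi) (h1 i hi)), Real.volume_Ioo]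
  -- Integrate the sum of the indicators, which is pointwise at most `k`.
  have hle : ∑ i ∈ S, ENNReal.ofReal (b i - a i) ≤ k * ENNReal.ofReal L := by
    rw [← Finset.sum_congr rfl hvol, ← MeasureTheory.lintegral_finsetSum]
    · calc _ ≤ ∫⁻ _ in Ioo 0 L, (k : ENNReal) := by
            refine MeasureTheory.lintegral_mono fun x => ?_
            have e : ∑ i ∈ S, (Ioo (a i) (b i)).indicator (1 : ℝ → ENNReal) x =
                (S.filter fun i => x ∈ Ioo (a i) (b i)).card := by
              rw [Finset.card_filter, Nat.cast_sum]
              refine Finset.sum_congr rfl fun i _ => ?_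
              by_cases hx : x ∈ Ioo (a i) (b i) <;> simp [hx]
            rw [e]
            exact Nat.cast_le.2 <| hk x _ (Finset.filter_subset _ _) fun i hi => (Finset.mem_filter.1 hi).2
        _ = k * ENNReal.ofReal L := by simp
    · exact fun i _ => measurable_one.indicator measurableSet_Ioo
  rw [← ENNReal.ofReal_sum_of_nonneg fun i hi => sub_nonneg.2 (hab i hi),
    ← ENNReal.ofReal_natCast, ← ENNReal.ofReal_mul (Nat.cast_nonneg k)] at hle
  exact (ENNReal.ofReal_le_ofReal_iff (by positivity)).1 hle

/-! ### Fibres of the semiconjugacy -/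

namespace CircleDeg1Lift

/-- The left end point of a fibre. -/
noncomputable def leftEnd (H : CircleDeg1Lift) (s : ℝ) : ℝ := sInf (H ⁻¹' {s})

/-- The right end point of a fibre. -/
noncomputable def rightEnd (H : CircleDeg1Lift) (s : ℝ) : ℝ := sSup (H ⁻¹' {s})

variable {H : CircleDeg1Lift} (hH : Continuous H)
include hH

theorem isLeast_leftEnd (s : ℝ) : IsLeast (H ⁻¹' {s}) (H.leftEnd s) := by
  have hb : BddBelow (H ⁻¹' {s}) := by
    obtain ⟨x, hx⟩ := H.surjective_of_continuous hH (s - 1)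
    refine ⟨x, fun y hy => ?_⟩
    by_contra! h
    have := H.monotone h.le
    rw [mem_preimage, mem_singleton_iff] at hy
    linarith
  have hne : (H ⁻¹' {s}).Nonempty := H.surjective_of_continuous hH s
  exact ⟨(isClosed_singleton.preimage hH).csInf_mem hne hb, fun y hy => csInf_le hb hy⟩

theorem isGreatest_rightEnd (s : ℝ) : IsGreatest (H ⁻¹' {s}) (H.rightEnd s) := by
  have hb : BddAbove (H ⁻¹' {s}) := by
    obtain ⟨x, hx⟩ := H.surjective_of_continuous hH (s + 1)
    refine ⟨x, fun y hy => ?_⟩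
    by_contra! h
    have := H.monotone h.le
    rw [mem_preimage, mem_singleton_iff] at hy
    linarith
  have hne : (H ⁻¹' {s}).Nonempty := H.surjective_of_continuous hH s
  exact ⟨(isClosed_singleton.preimage hH).csSup_mem hne hb, fun y hy => le_csSup hb hy⟩

theorem map_leftEnd (s : ℝ) : H (H.leftEnd s) = s := (isLeast_leftEnd hH s).1

theorem map_rightEnd (s : ℝ) : H (H.rightEnd s) = s := (isGreatest_rightEnd hH s).1

theorem leftEnd_le (x : ℝ) : H.leftEnd (H x) ≤ x := (isLeast_leftEnd hH (H x)).2 rfl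

theorem le_rightEnd (x : ℝ) : x ≤ H.rightEnd (H x) := (isGreatest_rightEnd hH (H x)).2 rfl

theorem leftEnd_le_rightEnd (s : ℝ) : H.leftEnd s ≤ H.rightEnd s :=
  (isLeast_leftEnd hH s).2 (map_rightEnd hH s)

theorem rightEnd_lt_leftEnd {s t : ℝ} (h : s < t) : H.rightEnd s < H.leftEnd t := by
  by_contra! hle
  have := H.monotone hle
  rw [map_leftEnd hH, map_rightEnd hH] at this
  linarith

theorem map_eq_of_mem_Icc {s x : ℝ} (hx : x ∈ Icc (H.leftEnd s) (H.rightEnd s)) : H x = s := by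
  have h1 := H.monotone hx.1
  have h2 := H.monotone hx.2
  rw [map_leftEnd hH] at h1
  rw [map_rightEnd hH] at h2
  exact le_antisymm h2 h1

theorem leftEnd_add_int (s : ℝ) (m : ℤ) : H.leftEnd (s + m) = H.leftEnd s + m := by
  refine (isLeast_leftEnd hH (s + m)).unique ⟨?_, fun x hx => ?_⟩
  · rw [mem_preimage, map_add_int, map_leftEnd hH]; rfl
  · have hx' : H (x - m) = s := by
      rw [mem_preimage, mem_singleton_iff] at hx
      rw [H.map_sub_int, hx, add_sub_cancel_right]
    have := leftEnd_le hH (x - m)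
    rw [hx'] at this
    linarith

theorem rightEnd_add_int (s : ℝ) (m : ℤ) : H.rightEnd (s + m) = H.rightEnd s + m := by
  refine (isGreatest_rightEnd hH (s + m)).unique ⟨?_, fun x hx => ?_⟩
  · rw [mem_preimage, map_add_int, map_rightEnd hH]; rfl
  · have hx' : H (x - m) = s := by
      rw [mem_preimage, mem_singleton_iff] at hx
      rw [H.map_sub_int, hx, add_sub_cancel_right]
    have := le_rightEnd hH (x - m)
    rw [hx'] at this
    linarith

variable {F : CircleDeg1Lift} (hF : Continuous F) {τ : ℝ} (hHF : ∀ x, H (F x) = H x + τ)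
include hF hHF

/-- Since `F` is onto, each point over `s + τ` is the image of a point over `s`; monotonicity then
makes the image of the least point least. -/
theorem semiconj_leftEnd (s : ℝ) : F (H.leftEnd s) = H.leftEnd (s + τ) := by
  refine (isLeast_leftEnd hH (s + τ)).unique ⟨?_, fun x hx => ?_⟩ |>.symm
  · rw [mem_preimage, hHF, map_leftEnd hH]; rfl
  · obtain ⟨w, rfl⟩ := F.surjective_of_continuous hF x
    rw [mem_preimage, hHF, mem_singleton_iff, add_left_inj] at hx
    exact F.monotone (hx ▸ leftEnd_le hH w)

theorem semiconj_rightEnd (s : ℝ) : F (H.rightEnd s) = H.rightEnd (s + τ) := by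
  refine (isGreatest_rightEnd hH (s + τ)).unique ⟨?_, fun x hx => ?_⟩ |>.symm
  · rw [mem_preimage, hHF, map_rightEnd hH]; rfl
  · obtain ⟨w, rfl⟩ := F.surjective_of_continuous hF x
    rw [mem_preimage, hHF, mem_singleton_iff, add_left_inj] at hx
    exact F.monotone (hx ▸ le_rightEnd hH w)

end CircleDeg1Lift

/-! ### Absence of wandering intervals -/

namespace FlatCircleMap

variable (f : FlatCircleMap)

theorem lift_eq_of_mem_Icc_add_one {x : ℝ} (hx : x ∈ Icc (f.a + 1) (f.b + 1)) :
    f.lift x = f.lift (f.a + 1) := by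
  have h1 := f.lift_eq_of_mem_Icc (x := x - 1) ⟨by linarith [hx.1], by linarith [hx.2]⟩
  have h2 := f.lift_eq_of_mem_Icc (x := f.a) ⟨le_rfl, f.a_lt_b.le⟩
  have h3 := f.lift.map_add_one (x - 1)
  have h4 := f.lift.map_add_one f.a
  rw [sub_add_cancel] at h3
  linarith

/-- Strict monotonicity and cross-ratio distortion of a map with a flat interval. -/
theorem exists_crossRatio_bounds : ∃ K C : ℝ, 1 ≤ K ∧ 0 ≤ C ∧
    (∀ (k : ℤ) (x y : ℝ), f.b + k < x → x < y → y < f.a + 1 + k → f.lift x < f.lift y) ∧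
    (∀ (k : ℤ) (a b c d : ℝ), a < b → b < c → c < d → f.b + k < a → d < f.a + 1 + k →
      ((c - a) * (d - b)) * ((f.lift b - f.lift a) * (f.lift d - f.lift c)) ≤
        Real.exp (C * (d - a)) *
          (((b - a) * (d - c)) * ((f.lift c - f.lift a) * (f.lift d - f.lift b)))) ∧
    (∀ (k : ℤ) (a b c d : ℝ), a < b → b < c → c < d → d - a ≤ 1 → f.b + k < b →
      c < f.a + 1 + k →
      ((c - a) * (d - b)) * ((f.lift b - f.lift a) * (f.lift d - f.lift c)) ≤
        K * (((b - a) * (d - c)) * ((f.lift c - f.lift a) * (f.lift d - f.lift b)))) := by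
  obtain ⟨G, p, C, h⟩ := f.exists_hasPowerLawDeriv
  have hκ : 0 < f.b - f.a := sub_pos.2 f.a_lt_b
  have hsub : ∀ x (k : ℤ), f.lift x = f.lift (x - k) + k := fun x k => by
    rw [f.lift.map_sub_int, sub_add_cancel]
  -- The summand `1` ensures `1 ≤ K`, so that powers of `K` grow with the number of exceptional
  -- steps.
  refine ⟨(2 ^ (p + 1) * Real.exp (2 * C * (f.a + 1 - f.b)) + 1 / (f.b - f.a)) ^ 2 + 1, 4 * C,
    by linarith [sq_nonneg (2 ^ (p + 1) * Real.exp (2 * C * (f.a + 1 - f.b)) + 1 / (f.b - f.a))],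
    by linarith [h.const_nonneg], fun k x y hx hxy hy => ?_,
    fun k a b c d hab hbc hcd ha hd => ?_, fun k a b c d hab hbc hcd hda hb hc => ?_⟩
  · rw [hsub x k, hsub y k, add_lt_add_iff_right]
    exact h.strictMonoOn ⟨by linarith, by linarith⟩ ⟨by linarith, by linarith⟩ (by linarith)
  · have := h.crossRatio_le_exp (a := a - k) (b := b - k) (c := c - k) (d := d - k) (by linarith)
      (by linarith) (by linarith) (by linarith) (by linarith)
    rw [hsub a k, hsub b k, hsub c k, hsub d k]
    simpa only [sub_sub_sub_cancel_right, add_sub_add_right_eq_sub] using this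
  · have := h.crossRatio_le_const f.lift.monotone f.continuous_lift hκ
      (fun x hx => f.lift_eq_of_mem_Icc ⟨by linarith [hx.1], hx.2⟩)
      (fun x hx => f.lift_eq_of_mem_Icc_add_one ⟨hx.1, by linarith [hx.2]⟩)
      (a := a - k) (b := b - k) (c := c - k) (d := d - k) (by linarith)
      (by linarith) (by linarith) (by linarith) (by linarith) (by linarith)
    have e : ∀ x, f.lift (x - k) = f.lift x - k := fun x => f.lift.map_sub_int x k
    simp only [e, sub_sub_sub_cancel_right] at this
    have h1 := f.lift.monotone hab.le
    have h2 := f.lift.monotone hbc.le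
    have h3 := f.lift.monotone hcd.le
    have nn : 0 ≤ ((b - a) * (d - c)) * ((f.lift c - f.lift a) * (f.lift d - f.lift b)) :=
      mul_nonneg (mul_nonneg (by linarith) (by linarith)) (mul_nonneg (by linarith) (by linarith))
    linarith

end FlatCircleMap

theorem le_prod_mul_of_le_mul {R κ : ℕ → ℝ} {n : ℕ} (hκ : ∀ i < n, 0 ≤ κ i)
    (h : ∀ i < n, R (i + 1) ≤ κ i * R i) : R n ≤ (∏ i ∈ Finset.range n, κ i) * R 0 := by
  induction n with
  | zero => simp
  | succ n ih =>
    rw [Finset.prod_range_succ, mul_comm _ (κ n), mul_assoc]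
    exact (h n n.lt_succ_self).trans (mul_le_mul_of_nonneg_left
      (ih (fun i hi => hκ i (hi.trans n.lt_succ_self)) fun i hi => h i (hi.trans n.lt_succ_self))
      (hκ n n.lt_succ_self))

theorem crossRatio_step {a b c d a' b' c' d' κ : ℝ} (hab : a < b) (hbc : b < c) (hcd : c < d)
    (hab' : a' < b') (hbc' : b' < c') (hcd' : c' < d')
    (h : ((c - a) * (d - b)) * ((b' - a') * (d' - c')) ≤
      κ * (((b - a) * (d - c)) * ((c' - a') * (d' - b')))) :
    (b' - a') * (d' - c') / ((c' - a') * (d' - b')) ≤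
      κ * ((b - a) * (d - c) / ((c - a) * (d - b))) := by
  have h1 : 0 < (c - a) * (d - b) := mul_pos (by linarith) (by linarith)
  have h2 : 0 < (c' - a') * (d' - b') := mul_pos (by linarith) (by linarith)
  rw [mul_div_assoc', div_le_div_iff₀ h2 h1]
  linarith

namespace FlatCircleMap

variable (f : FlatCircleMap) {H : CircleDeg1Lift} {τ : ℝ}

/-- The quantitative core of the absence of wandering intervals: a fibre that never meets the flat
interval has definite space around it inside arbitrarily short arcs of the rotation. -/
theorem exists_space_around_fibre (hH : Continuous H)
    (hHF : ∀ x, H (f.lift x) = H x + τ) (hirr : Irrational τ) {s : ℝ}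
    (hs : ∀ (n : ℕ) (m : ℤ), s + n * τ ≠ H f.b + m) (hlt : H.leftEnd s < H.rightEnd s) :
    ∃ η : ℝ, 0 < η ∧ ∀ ε > 0, ∃ e, 0 < e ∧ e < ε ∧ H.leftEnd (s - e) ≤ H.leftEnd s - η := by
  classical
  obtain ⟨K, C, hK, hC, hstrict, hgood, hbad⟩ := f.exists_crossRatio_bounds
  have hQ : 0 < K ^ 5 * Real.exp (C * 10) := by positivity
  -- The `4` comes from the final cross-ratio, `K ^ 5` from at most five exceptional steps, and `exp
  -- (C * 10)` from total length at most `10`. None depends on `ε`.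
  refine ⟨(H.rightEnd s - H.leftEnd s) / (4 * (K ^ 5 * Real.exp (C * 10))),
    div_pos (sub_pos.2 hlt) (by positivity), fun ε hε => ?_⟩
  have hHa : H f.a = H f.b := by
    have h1 := hHF f.a
    rw [f.lift_eq_of_mem_Icc ⟨le_rfl, f.a_lt_b.le⟩, hHF] at h1
    linarith
  have hb1 : ∀ k : ℤ, f.b + k ≤ H.rightEnd (H f.b + k) := fun k => by
    rw [← H.map_add_int]; exact CircleDeg1Lift.le_rightEnd hH _
  have ha1 : ∀ k : ℤ, H.leftEnd (H f.b + k + 1) ≤ f.a + 1 + k := fun k => by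
    have := CircleDeg1Lift.leftEnd_le hH (f.a + 1 + k)
    rwa [H.map_add_int, H.map_add_one, hHa, add_right_comm] at this
  -- fibres over `(k, k + 1)` avoid the flat interval
  have avoid : ∀ (k : ℤ) (t u : ℝ), H f.b + k < t → u < H f.b + k + 1 →
      f.b + k < H.leftEnd t ∧ H.rightEnd u < f.a + 1 + k := fun k t u ht hu =>
    ⟨(hb1 k).trans_lt (CircleDeg1Lift.rightEnd_lt_leftEnd hH ht),
      (CircleDeg1Lift.rightEnd_lt_leftEnd hH hu).trans_le (ha1 k)⟩
  have loc : ∀ i : ℕ, ∃ k : ℤ, H f.b + k < s + i * τ ∧ s + i * τ < H f.b + k + 1 := by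
    intro i
    refine ⟨⌊s + i * τ - H f.b⌋, lt_of_le_of_ne ?_ (hs i _).symm, ?_⟩
    · linarith [Int.floor_le (s + i * τ - H f.b)]
    · linarith [Int.lt_floor_add_one (s + i * τ - H f.b)]
  have stepL : ∀ (t : ℝ) (i : ℕ), f.lift (H.leftEnd (t + i * τ)) =
      H.leftEnd (t + (i + 1 : ℕ) * τ) := fun t i => by
    rw [CircleDeg1Lift.semiconj_leftEnd hH f.continuous_lift hHF]
    push_cast
    ring_nf
  have stepR : ∀ (t : ℝ) (i : ℕ), f.lift (H.rightEnd (t + i * τ)) =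
      H.rightEnd (t + (i + 1 : ℕ) * τ) := fun t i => by
    rw [CircleDeg1Lift.semiconj_rightEnd hH f.continuous_lift hHF]
    push_cast
    ring_nf
  have nondeg : ∀ i : ℕ, H.leftEnd (s + i * τ) < H.rightEnd (s + i * τ) := by
    intro i
    induction i with
    | zero => simpa using hlt
    | succ i ih =>
      obtain ⟨k, h1, h2⟩ := loc i
      obtain ⟨h3, h4⟩ := avoid k _ _ h1 h2
      have := hstrict k _ _ h3 ih h4
      rwa [stepL, stepR] at this
  -- Neighbours lie within `2 δ`: `δ < ε / 2` puts them within `ε`, and `δ < 1 / 4` keeps the whole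
  -- configuration shorter than one turn.
  obtain ⟨N, k₀, p, q, hk0, hkN, hδ, hδε, hrec, hN⟩ :=
    hirr.exists_record (show 0 < min (ε / 2) (1 / 4) by positivity)
  set δ := |k₀ * τ - p| with hδdef
  have hδ1 : δ < ε / 2 := hδε.trans_le (min_le_left _ _)
  have hδ2 : δ < 1 / 4 := hδε.trans_le (min_le_right _ _)
  have sep : ∀ i < N, ∀ j < N, i ≠ j → ∀ m : ℤ, δ ≤ |(i - j) * τ - m| := by
    intro i hi j hj hij m
    rcases hij.lt_or_gt with h | h
    · have := hrec (j - i) (by omega) (by omega) (-m)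
      rw [Nat.cast_sub h.le] at this
      rw [abs_sub_comm]
      refine this.trans (le_of_eq ?_)
      congr 1
      push_cast
      ring
    · have := hrec (i - j) (by omega) (by omega) m
      rwa [Nat.cast_sub h.le] at this
  -- the shortest fibre and its neighbours
  obtain ⟨n, hn, hmin⟩ := Finset.exists_min_image (Finset.range N)
    (fun i : ℕ => H.rightEnd (s + i * τ) - H.leftEnd (s + i * τ)) ⟨k₀, Finset.mem_range.2 hkN⟩
  rw [Finset.mem_range] at hn
  obtain ⟨⟨r, hr, mr, hr1, hr2⟩, ⟨l, hl, ml, hl1, hl2⟩⟩ := exists_orbit_neighbours hkN hδ hN hn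
  set e₁ := (r - n) * τ + mr with he₁
  set e₂ := -((l - n) * τ + ml) with he₂
  have he2 : 0 < e₂ := by linarith
  have he2' : e₂ < 2 * δ := by linarith
  refine ⟨e₂, he2, by linarith, ?_⟩
  -- The configuration found at time `n` is pulled back along the rotation, so that `F` takes the
  -- four points at time `i` to those at time `i + 1`.
  set a : ℕ → ℝ := fun i => H.leftEnd (s - e₂ + i * τ) with ha
  set b : ℕ → ℝ := fun i => H.leftEnd (s + i * τ) with hb
  set c : ℕ → ℝ := fun i => H.rightEnd (s + i * τ) with hc
  set d : ℕ → ℝ := fun i => H.rightEnd (s + e₁ + i * τ) with hd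
  have hab : ∀ i, a i < b i := fun i =>
    (CircleDeg1Lift.leftEnd_le_rightEnd hH _).trans_lt
      (CircleDeg1Lift.rightEnd_lt_leftEnd hH (by linarith))
  have hbc : ∀ i, b i < c i := nondeg
  have hcd : ∀ i, c i < d i := fun i =>
    (CircleDeg1Lift.rightEnd_lt_leftEnd hH (by linarith)).trans_le
      (CircleDeg1Lift.leftEnd_le_rightEnd hH _)
  have hda : ∀ i, d i - a i ≤ 1 := by
    intro i
    have h1 := CircleDeg1Lift.leftEnd_add_int hH (s - e₂ + i * τ) 1
    have h2 : d i < H.leftEnd (s - e₂ + i * τ + (1 : ℤ)) :=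
      CircleDeg1Lift.rightEnd_lt_leftEnd hH (by push_cast; linarith)
    rw [h1] at h2
    push_cast at h2
    simp only [ha]
    linarith
  have hRpos : ∀ i, 0 < (c i - a i) * (d i - b i) := fun i =>
    mul_pos (by linarith [hab i, hbc i]) (by linarith [hbc i, hcd i])
  set R : ℕ → ℝ := fun i => (b i - a i) * (d i - c i) / ((c i - a i) * (d i - b i)) with hR
  -- the final cross-ratio is not small
  have hRn : 1 / 4 ≤ R n := by
    -- The fibre starting at `a n` is an integer translate of the one over `s + l * τ`. It is no
    -- shorter than the minimal fibre `[b n, c n]` and fits into `[a n, b n]`; likewise on the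
    -- right.
    have hbn : c n - b n ≤ b n - a n := by
      have e : s - e₂ + n * τ = s + l * τ + ml := by rw [he₂]; ring
      have h1 : c l - b l = H.rightEnd (s - e₂ + n * τ) - a n := by
        simp only [ha]
        rw [e, CircleDeg1Lift.leftEnd_add_int hH, CircleDeg1Lift.rightEnd_add_int hH]
        ring
      have h2 : H.rightEnd (s - e₂ + n * τ) < b n :=
        CircleDeg1Lift.rightEnd_lt_leftEnd hH (by linarith)
      have h3 := hmin l (Finset.mem_range.2 hl)
      simp only [hb, hc] at h1 h2 ⊢
      linarith
    have hdn : c n - b n ≤ d n - c n := by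
      have e : s + e₁ + n * τ = s + r * τ + mr := by rw [he₁]; ring
      have h1 : c r - b r = d n - H.leftEnd (s + e₁ + n * τ) := by
        simp only [hd]
        rw [e, CircleDeg1Lift.leftEnd_add_int hH, CircleDeg1Lift.rightEnd_add_int hH]
        ring
      have h2 : c n < H.leftEnd (s + e₁ + n * τ) :=
        CircleDeg1Lift.rightEnd_lt_leftEnd hH (by linarith)
      have h3 := hmin r (Finset.mem_range.2 hr)
      simp only [hb, hc] at h1 h2 ⊢
      linarith
    simp only [hR]
    rw [div_le_div_iff₀ (by norm_num) (hRpos n)]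
    have := mul_le_mul (show c n - a n ≤ 2 * (b n - a n) by linarith)
      (show d n - b n ≤ 2 * (d n - c n) by linarith) (by linarith [hbc n, hcd n])
      (by linarith [hab n])
    linarith
  -- the intervals that meet the flat interval
  set bad : Finset ℕ := (Finset.range n).filter
    (fun i => ¬ ∃ k : ℤ, f.b + k < a i ∧ d i < f.a + 1 + k) with hbaddef
  have sep' : ∀ (T : Finset ℕ), T ⊆ Finset.range n → ∀ k : ℕ → ℤ, ∀ i ∈ T, ∀ j ∈ T, i ≠ j →
      δ ≤ |(s + i * τ - k i) - (s + j * τ - k j)| := by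
    intro T hT k i hi j hj hij
    have hi' := (Finset.mem_range.1 (hT hi)).trans hn
    have hj' := (Finset.mem_range.1 (hT hj)).trans hn
    refine (sep i hi' j hj' hij (k i - k j)).trans (le_of_eq ?_)
    congr 1
    push_cast
    ring
  have hbadcard : bad.card ≤ 5 := by
    -- The configuration reaches less than `2 δ` to either side of `s + i * τ`, so it can meet the
    -- flat interval only if that point is within `2 δ` of an integer translate of `H f.b`.
    have hex : ∀ i ∈ bad, ∃ k : ℤ, |s + i * τ - k - H f.b| ≤ 2 * δ := by
      intro i hi
      obtain ⟨k, h1, h2⟩ := loc i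
      by_contra! hno
      refine (Finset.mem_filter.1 hi).2 ⟨k, ?_⟩
      have n1 := hno k
      have n2 := hno (k + 1)
      rw [abs_of_nonneg (by linarith)] at n1
      rw [abs_of_nonpos (by push_cast; linarith)] at n2
      push_cast at n2
      exact avoid k _ _ (by linarith) (by linarith)
    choose! k hk using hex
    exact card_le_five_of_separated (t := fun i : ℕ => s + i * τ - k i) hδ
      (sep' bad (Finset.filter_subset _ _) k) hk
  -- Integer translations bring all the intervals into `[0, 2]`. Those containing a given `x` have
  -- centres within `2 δ` of `H x`, so there are at most five, and `5 * 2 = 10`.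
  have hlen : ∑ i ∈ Finset.range n, (d i - a i) ≤ 10 := by
    have := sum_length_le_of_multiplicity (Finset.range n) (fun i => a i - ⌊a i⌋)
      (fun i => d i - ⌊a i⌋) 5 (L := 2) (by norm_num)
      (fun i _ => by linarith [Int.floor_le (a i)])
      (fun i _ => by linarith [Int.lt_floor_add_one (a i), hda i])
      (fun i _ => by linarith [hab i, hbc i, hcd i])
      (fun x T hT hx => by
        refine card_le_five_of_separated (t := fun i : ℕ => s + i * τ - ⌊a i⌋) (p := H x) hδ
          (sep' T hT _) fun i hi => ?_
        obtain ⟨h1, h2⟩ := hx i hi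
        have m1 := H.monotone h1.le
        have m2 := H.monotone h2.le
        rw [H.map_sub_int] at m1 m2
        simp only [ha, hd] at m1 m2 ⊢
        rw [CircleDeg1Lift.map_leftEnd hH] at m1
        rw [CircleDeg1Lift.map_rightEnd hH] at m2
        rw [abs_le]
        constructor <;> linarith)
    simp only [sub_sub_sub_cancel_right] at this
    exact this.trans (by norm_num)
  -- propagate the cross-ratio
  have hprop := le_prod_mul_of_le_mul (R := R) (n := n)
    (κ := fun i => (if i ∈ bad then K else 1) * Real.exp (C * (d i - a i)))
    (fun i _ => by positivity) (fun i hi => by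
      have e1 : ∀ i, f.lift (a i) = a (i + 1) := stepL _
      have e2 : ∀ i, f.lift (b i) = b (i + 1) := stepL _
      have e3 : ∀ i, f.lift (c i) = c (i + 1) := stepR _
      have e4 : ∀ i, f.lift (d i) = d (i + 1) := stepR _
      refine crossRatio_step (hab i) (hbc i) (hcd i) (hab _) (hbc _) (hcd _) ?_
      rw [← e1, ← e2, ← e3, ← e4]
      have m1 := f.lift.monotone ((hab i).le.trans (hbc i).le)
      have m2 := f.lift.monotone ((hbc i).le.trans (hcd i).le)
      have nn : 0 ≤ ((b i - a i) * (d i - c i)) *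
          ((f.lift (c i) - f.lift (a i)) * (f.lift (d i) - f.lift (b i))) :=
        mul_nonneg (mul_nonneg (by linarith [hab i]) (by linarith [hcd i]))
          (mul_nonneg (by linarith) (by linarith))
      by_cases hb' : i ∈ bad
      · rw [if_pos hb']
        obtain ⟨k, h1, h2⟩ := loc i
        obtain ⟨h3, h4⟩ := avoid k _ _ h1 h2
        refine (hbad k _ _ _ _ (hab i) (hbc i) (hcd i) (hda i) h3 h4).trans ?_
        refine mul_le_mul_of_nonneg_right (le_mul_of_one_le_right (by linarith) ?_) nn
        refine Real.one_le_exp (mul_nonneg hC ?_)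
        linarith [hab i, hbc i, hcd i]
      · rw [if_neg hb', one_mul]
        have : ∃ k : ℤ, f.b + k < a i ∧ d i < f.a + 1 + k := by
          by_contra hno
          exact hb' (Finset.mem_filter.2 ⟨Finset.mem_range.2 hi, hno⟩)
        obtain ⟨k, h1, h2⟩ := this
        exact hgood k _ _ _ _ (hab i) (hbc i) (hcd i) h1 h2)
  have hprod : ∏ i ∈ Finset.range n, (if i ∈ bad then K else 1) * Real.exp (C * (d i - a i)) ≤
      K ^ 5 * Real.exp (C * 10) := by
    rw [Finset.prod_mul_distrib, ← Real.exp_sum, ← Finset.mul_sum]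
    refine mul_le_mul ?_ (Real.exp_le_exp.2 (mul_le_mul_of_nonneg_left hlen hC))
      (Real.exp_pos _).le (by positivity)
    rw [Finset.prod_ite, Finset.prod_const, Finset.prod_const_one, mul_one]
    refine pow_le_pow_right₀ hK (le_trans (Finset.card_le_card fun i hi => ?_) hbadcard)
    exact (Finset.mem_filter.1 hi).2
  have hR0 : R 0 ≤ (b 0 - a 0) / (c 0 - b 0) := by
    simp only [hR]
    rw [div_le_div_iff₀ (hRpos 0) (by linarith [hbc 0])]
    have h1 : (d 0 - c 0) * (c 0 - b 0) ≤ (d 0 - b 0) * (c 0 - a 0) :=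
      mul_le_mul (by linarith [hbc 0]) (by linarith [hab 0]) (by linarith [hbc 0])
        (by linarith [hbc 0, hcd 0])
    have := mul_le_mul_of_nonneg_left h1 (show 0 ≤ b 0 - a 0 by linarith [hab 0])
    linarith
  have hbc0 : 0 < c 0 - b 0 := sub_pos.2 (hbc 0)
  have hfin : 1 / 4 ≤ K ^ 5 * Real.exp (C * 10) * ((b 0 - a 0) / (c 0 - b 0)) := by
    have hR0' : 0 ≤ R 0 := div_nonneg (mul_nonneg (by linarith [hab 0]) (by linarith [hcd 0]))
      (hRpos 0).le
    exact hRn.trans (hprop.trans (mul_le_mul hprod hR0 hR0' hQ.le))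
  rw [mul_div_assoc', le_div_iff₀ hbc0] at hfin
  have hfin2 : (c 0 - b 0) / (4 * (K ^ 5 * Real.exp (C * 10))) ≤ b 0 - a 0 := by
    rw [div_le_iff₀ (by positivity)]
    linarith
  simp only [ha, hb, hc, Nat.cast_zero, zero_mul, add_zero] at hfin2
  linarith

/-- Absence of wandering intervals: a fibre of the semiconjugacy to the rotation that never meets
the flat interval is a point. -/
theorem leftEnd_eq_rightEnd (hH : Continuous H)
    (hHF : ∀ x, H (f.lift x) = H x + τ) (hirr : Irrational τ) {s : ℝ}
    (hs : ∀ (n : ℕ) (m : ℤ), s + n * τ ≠ H f.b + m) : H.leftEnd s = H.rightEnd s := by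
  by_contra hne
  have hlt := lt_of_le_of_ne (CircleDeg1Lift.leftEnd_le_rightEnd hH s) hne
  obtain ⟨η, hη, h⟩ := f.exists_space_around_fibre hH hHF hirr hs hlt
  have h1 : H (H.leftEnd s - η) < s := by
    refine lt_of_le_of_ne ?_ fun h2 => ?_
    · have := H.monotone (show H.leftEnd s - η ≤ H.leftEnd s by linarith)
      rwa [CircleDeg1Lift.map_leftEnd hH] at this
    · have := (CircleDeg1Lift.isLeast_leftEnd hH s).2 h2
      linarith
  -- The space `η` covers a rotation arc of fixed positive length `s - H (H.leftEnd s - η)`, but is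
  -- supposed to fit inside a shorter one.
  obtain ⟨e, -, he, hle⟩ := h _ (sub_pos.2 h1)
  have := H.monotone hle
  rw [CircleDeg1Lift.map_leftEnd hH] at this
  linarith

end FlatCircleMap

/-! ### Matching the fibres of two maps -/

namespace CircleDeg1Lift

/-- Two monotone degree one maps whose nondegenerate fibres correspond under a translation are
conjugate by an order isomorphism matching the end points of the fibres. -/
theorem exists_orderIso_of_fibres {H₁ H₂ : CircleDeg1Lift} (h₁ : Continuous H₁)
    (h₂ : Continuous H₂) (σ : ℝ)
    (hdeg : ∀ s, H₁.leftEnd s = H₁.rightEnd s ↔ H₂.leftEnd (s + σ) = H₂.rightEnd (s + σ)) :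
    ∃ Φ : ℝ ≃o ℝ, (∀ x, Φ (x + 1) = Φ x + 1) ∧ (∀ s, Φ (H₁.leftEnd s) = H₂.leftEnd (s + σ)) ∧
      ∀ s, Φ (H₁.rightEnd s) = H₂.rightEnd (s + σ) := by
  -- `g s` maps the fibre over `s` affinely onto the fibre over `s + σ`. If the first is a point,
  -- division by zero gives `0` and `g s` is constantly the left end, which is correct because the
  -- second is then a point too.
  set g : ℝ → ℝ → ℝ := fun s x => H₂.leftEnd (s + σ) + (x - H₁.leftEnd s) /
    (H₁.rightEnd s - H₁.leftEnd s) * (H₂.rightEnd (s + σ) - H₂.leftEnd (s + σ)) with hg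
  have len₂ : ∀ s, 0 ≤ H₂.rightEnd s - H₂.leftEnd s := fun s =>
    sub_nonneg.2 (leftEnd_le_rightEnd h₂ s)
  have len₁ : ∀ s, 0 ≤ H₁.rightEnd s - H₁.leftEnd s := fun s =>
    sub_nonneg.2 (leftEnd_le_rightEnd h₁ s)
  have gL : ∀ s, g s (H₁.leftEnd s) = H₂.leftEnd (s + σ) := fun s => by simp [hg]
  have gR : ∀ s, g s (H₁.rightEnd s) = H₂.rightEnd (s + σ) := by
    intro s
    by_cases h : H₁.leftEnd s = H₁.rightEnd s
    · rw [← h, gL, (hdeg s).1 h]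
    · have : H₁.rightEnd s - H₁.leftEnd s ≠ 0 := sub_ne_zero.2 (Ne.symm h)
      simp only [hg]
      rw [div_self this]
      ring
  have gmono : ∀ s, Monotone (g s) := fun s x y hxy => by
    have := len₁ s
    have := len₂ (s + σ)
    simp only [hg]
    gcongr
  have gstrict : ∀ s x y, x < y → H₁ x = s → H₁ y = s → g s x < g s y := by
    intro s x y hxy hx hy
    have hlt : H₁.leftEnd s < H₁.rightEnd s :=
      ((hx ▸ leftEnd_le h₁ x).trans_lt hxy).trans_le (hy ▸ le_rightEnd h₁ y)
    have hlt₂ : H₂.leftEnd (s + σ) < H₂.rightEnd (s + σ) :=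
      lt_of_le_of_ne (leftEnd_le_rightEnd h₂ _) fun h => hlt.ne ((hdeg s).2 h)
    have := sub_pos.2 hlt
    have := sub_pos.2 hlt₂
    simp only [hg]
    gcongr
  have hmono : StrictMono fun x => g (H₁ x) x := by
    intro x y hxy
    rcases (H₁.monotone hxy.le).lt_or_eq with h | h
    · have k1 := gmono (H₁ x) (le_rightEnd h₁ x)
      have k2 := gmono (H₁ y) (leftEnd_le h₁ y)
      rw [gR] at k1
      rw [gL] at k2
      exact (k1.trans_lt (rightEnd_lt_leftEnd h₂ (by linarith))).trans_le k2
    · simp only [h]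
      exact gstrict _ x y hxy h rfl
  have hsurj : Function.Surjective fun x => g (H₁ x) x := by
    intro y
    set s := H₂ y - σ with hs
    have hsσ : s + σ = H₂ y := by rw [hs, sub_add_cancel]
    have hL : H₂.leftEnd (s + σ) ≤ y := hsσ ▸ leftEnd_le h₂ y
    have hR : y ≤ H₂.rightEnd (s + σ) := hsσ ▸ le_rightEnd h₂ y
    have hc : ContinuousOn (g s) (Icc (H₁.leftEnd s) (H₁.rightEnd s)) := by
      simp only [hg]
      fun_prop
    obtain ⟨x, hx, hxy⟩ := intermediate_value_Icc (leftEnd_le_rightEnd h₁ s) hc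
      (show y ∈ Icc (g s (H₁.leftEnd s)) (g s (H₁.rightEnd s)) by
        rw [gL, gR]; exact ⟨hL, hR⟩)
    exact ⟨x, by simp only [map_eq_of_mem_Icc h₁ hx, hxy]⟩
  refine ⟨hmono.orderIsoOfSurjective _ hsurj, fun x => ?_, fun s => ?_, fun s => ?_⟩
  · have e1 := leftEnd_add_int h₁ (H₁ x) 1
    have e2 := rightEnd_add_int h₁ (H₁ x) 1
    have e3 := leftEnd_add_int h₂ (H₁ x + σ) 1
    have e4 := rightEnd_add_int h₂ (H₁ x + σ) 1
    push_cast at e1 e2 e3 e4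
    simp only [StrictMono.coe_orderIsoOfSurjective, hg, H₁.map_add_one, e1, e2,
      add_right_comm _ (1 : ℝ) σ, e3, e4, add_sub_add_right_eq_sub]
    ring
  · simp only [StrictMono.coe_orderIsoOfSurjective, map_leftEnd h₁, gL]
  · simp only [StrictMono.coe_orderIsoOfSurjective, map_rightEnd h₁, gR]

end CircleDeg1Lift

/-- An increasing homeomorphism of the line commuting with the unit translation descends to the
circle. -/
theorem OrderIso.exists_homeomorph_unitAddCircle (Φ : ℝ ≃o ℝ) (hΦ : ∀ x, Φ (x + 1) = Φ x + 1) :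
    ∃ φ : UnitAddCircle ≃ₜ UnitAddCircle, ∀ x : ℝ, φ x = (Φ x : ℝ) := by
  have key : ∀ Ψ : ℝ ≃o ℝ, (∀ x, Ψ (x + 1) = Ψ x + 1) →
      ∃ φ : UnitAddCircle → UnitAddCircle, Continuous φ ∧ ∀ x : ℝ, φ x = (Ψ x : ℝ) := by
    intro Ψ hΨ
    have hper : Function.Periodic (fun x : ℝ => ((Ψ x : ℝ) : UnitAddCircle)) 1 := fun x => by
      simp only [hΨ]
      exact AddCircle.coe_add_period 1 _
    refine ⟨hper.lift, ?_, fun x => hper.lift_coe x⟩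
    refine (QuotientAddGroup.isQuotientMap_mk
      (N := AddSubgroup.zmultiples (1 : ℝ))).continuous_iff.2 ?_
    exact (AddCircle.continuous_mk' (1 : ℝ)).comp Ψ.continuous
  obtain ⟨φ, hφ, h⟩ := key Φ hΦ
  obtain ⟨ψ, hψ, h'⟩ := key Φ.symm fun x => by
    rw [OrderIso.symm_apply_eq, hΦ, OrderIso.apply_symm_apply]
  refine ⟨⟨⟨φ, ψ, fun x => ?_, fun x => ?_⟩, hφ, hψ⟩, h⟩
  · induction x using QuotientAddGroup.induction_on with | H x => ?_
    exact (congrArg ψ (h x)).trans ((h' _).trans (by rw [Φ.symm_apply_apply]))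
  · induction x using QuotientAddGroup.induction_on with | H x => ?_
    exact (congrArg φ (h' x)).trans ((h _).trans (by rw [Φ.apply_symm_apply]))

theorem UnitAddCircle.coe_eq_coe_iff {x y : ℝ} :
    (x : UnitAddCircle) = y ↔ ∃ m : ℤ, y = x + m := by
  rw [QuotientAddGroup.eq, AddSubgroup.mem_zmultiples_iff]
  refine exists_congr fun m => ?_
  rw [zsmul_eq_mul, mul_one]
  constructor <;> intro h <;> linarith

/-! ### The non-wandering set and the conjugacy -/

namespace FlatCircleMap

variable (f : FlatCircleMap) {H : CircleDeg1Lift} {τ : ℝ}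

theorem iterate_coe (n : ℕ) (x : ℝ) : f^[n] (x : UnitAddCircle) = ((f.lift^[n] x : ℝ)) := by
  induction n with
  | zero => rfl
  | succ n ih =>
    rw [Function.iterate_succ_apply', Function.iterate_succ_apply', ih]
    exact f.coe_lift _

theorem semiconj_iterate (hHF : ∀ x, H (f.lift x) = H x + τ) (n : ℕ) (x : ℝ) :
    H (f.lift^[n] x) = H x + n * τ := by
  induction n with
  | zero => simp
  | succ n ih =>
    rw [Function.iterate_succ_apply', hHF, ih]
    push_cast
    ring

/-- The non-wandering set consists of the end points of the fibres of the semiconjugacy. -/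
theorem coe_mem_K_iff (hH : Continuous H) (hHF : ∀ x, H (f.lift x) = H x + τ)
    (hirr : Irrational τ) {x : ℝ} :
    (x : UnitAddCircle) ∈ f.K ↔ x = H.leftEnd (H x) ∨ x = H.rightEnd (H x) := by
  constructor
  · intro hx
    by_contra! hne
    have h1 := lt_of_le_of_ne (CircleDeg1Lift.leftEnd_le hH x) hne.1.symm
    have h2 := lt_of_le_of_ne (CircleDeg1Lift.le_rightEnd hH x) hne.2
    obtain ⟨n, hn, _, ⟨y, hy, rfl⟩, ⟨_, ⟨z, hz, rfl⟩, hzy⟩⟩ := hx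
      ((fun y : ℝ => (y : UnitAddCircle)) '' Ioo (H.leftEnd (H x)) (H.rightEnd (H x)))
      (QuotientAddGroup.isOpenMap_coe _ isOpen_Ioo) ⟨x, ⟨h1, h2⟩, rfl⟩
    rw [iterate_coe, UnitAddCircle.coe_eq_coe_iff] at hzy
    obtain ⟨m, hm⟩ := hzy
    have e1 := CircleDeg1Lift.map_eq_of_mem_Icc hH (Ioo_subset_Icc_self hy)
    have e2 := CircleDeg1Lift.map_eq_of_mem_Icc hH (Ioo_subset_Icc_self hz)
    rw [hm, H.map_add_int, f.semiconj_iterate hHF, e2] at e1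
    exact (hirr.natCast_mul hn.ne').ne_int (-m) (by push_cast; linarith)
  · intro hx V hV hxV
    have hnb : (fun y : ℝ => (y : UnitAddCircle)) ⁻¹' V ∈ 𝓝 x :=
      (hV.preimage (AddCircle.continuous_mk' (1 : ℝ))).mem_nhds hxV
    obtain ⟨u, v, ⟨hux, hxv⟩, huv⟩ := mem_nhds_iff_exists_Ioo_subset.1 hnb
    have hlt : H u < H v := by
      -- Otherwise `u` and `v` lie in the fibre of `x`, on both sides of `x`, and `x` is not an end
      -- point.
      refine lt_of_le_of_ne (H.monotone (hux.trans hxv).le) fun h => ?_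
      have e1 : H u = H x := le_antisymm (H.monotone hux.le) (h ▸ H.monotone hxv.le)
      have e2 : H v = H x := h ▸ e1
      rcases hx with hx | hx
      · have := CircleDeg1Lift.leftEnd_le hH u
        rw [e1] at this
        linarith
      · have := CircleDeg1Lift.le_rightEnd hH v
        rw [e2] at this
        linarith
    obtain ⟨_, n, p, _, hn, _, -, hp, -⟩ :=
      hirr.exists_record (show 0 < (H v - H u) / 2 by linarith)
    -- Start over the midpoint of `(H u, H v)`: the chosen return moves the value of `H` by less
    -- than half the length of this interval.
    obtain ⟨y, hy⟩ := H.surjective_of_continuous hH ((H u + H v) / 2)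
    have hp' := abs_lt.1 hp
    have mem : ∀ z, H u < H z → H z < H v → z ∈ Ioo u v := fun z h1 h2 =>
      ⟨lt_of_not_ge fun h => (H.monotone h).not_gt h1, lt_of_not_ge fun h => (H.monotone h).not_gt h2⟩
    refine ⟨n, hn, ((f.lift^[n] y - p : ℝ) : UnitAddCircle), huv (mem _ ?_ ?_), y,
      huv (mem _ ?_ ?_), ?_⟩
    · rw [H.map_sub_int, f.semiconj_iterate hHF]; linarith
    · rw [H.map_sub_int, f.semiconj_iterate hHF]; linarith
    · linarith
    · linarith
    · rw [iterate_coe, UnitAddCircle.coe_eq_coe_iff]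
      exact ⟨-p, by push_cast; ring⟩

/-- The nondegenerate fibres are those over the backward orbit of the flat interval. -/
theorem leftEnd_eq_rightEnd_iff (hH : Continuous H) (hHF : ∀ x, H (f.lift x) = H x + τ)
    (hirr : Irrational τ) (s : ℝ) :
    H.leftEnd s = H.rightEnd s ↔ ∀ (n : ℕ) (m : ℤ), s + n * τ ≠ H f.b + m := by
  refine ⟨fun h n m hnm => ?_, f.leftEnd_eq_rightEnd hH hHF hirr⟩
  -- A degenerate fibre has only degenerate images, whereas the fibre over `H f.b` contains `[f.a,
  -- f.b]`.
  have step : ∀ n : ℕ, H.leftEnd (s + n * τ) = H.rightEnd (s + n * τ) := by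
    intro n
    induction n with
    | zero => simpa using h
    | succ n ih =>
      have := congrArg f.lift ih
      rw [CircleDeg1Lift.semiconj_leftEnd hH f.continuous_lift hHF,
        CircleDeg1Lift.semiconj_rightEnd hH f.continuous_lift hHF] at this
      push_cast
      rwa [add_mul, one_mul, ← add_assoc]
  have h1 := step n
  have hHa : H f.a = H f.b := by
    have h1 := hHF f.a
    rw [f.lift_eq_of_mem_Icc ⟨le_rfl, f.a_lt_b.le⟩, hHF] at h1
    linarith
  rw [hnm, CircleDeg1Lift.leftEnd_add_int hH, CircleDeg1Lift.rightEnd_add_int hH] at h1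
  have h2 := CircleDeg1Lift.leftEnd_le hH f.a
  have h3 := CircleDeg1Lift.le_rightEnd hH f.b
  rw [hHa] at h2
  linarith [f.a_lt_b]

theorem irrational_translationNumber (h : Irrational f.rotationNumber) :
    Irrational f.lift.translationNumber := by
  have := h.add_intCast ⌊f.lift.translationNumber⌋
  rwa [rotationNumber, Int.fract_add_floor] at this

end FlatCircleMap

theorem mainTheorem2 (f g : FlatCircleMap) (hf : f.IsClassB) (hg : g.IsClassB)
    (hρ : f.rotationNumber = g.rotationNumber) :
    ∃ φ : f.K ≃ₜ g.K, ∀ x : f.K, φ (f.restrictK x) = g.restrictK (φ x) := by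
  have hτf := f.irrational_translationNumber hf.irrational
  have hτg := g.irrational_translationNumber hg.irrational
  obtain ⟨H₁, c₁, s₁⟩ := f.lift.exists_semiconj_translation f.continuous_lift hτf
  obtain ⟨H₂, c₂, s₂⟩ := g.lift.exists_semiconj_translation g.continuous_lift hτg
  obtain ⟨k, hk⟩ : ∃ k : ℤ, g.lift.translationNumber = f.lift.translationNumber + k := by
    obtain ⟨k, hk⟩ := Int.fract_eq_fract.1 hρ.symm
    exact ⟨k, by linarith⟩
  -- This shift aligns the fibres of the two flat intervals, hence also their backward orbits. The
  -- translation numbers differ by the integer `k`, which is absorbed into `m`.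
  set σ := H₂ g.b - H₁ f.b with hσ
  obtain ⟨Φ, hΦ1, hΦL, hΦR⟩ := CircleDeg1Lift.exists_orderIso_of_fibres c₁ c₂ σ (fun s => by
    rw [f.leftEnd_eq_rightEnd_iff c₁ s₁ hτf, g.leftEnd_eq_rightEnd_iff c₂ s₂ hτg, hk]
    refine ⟨fun h n m hnm => h n (m - n * k) ?_, fun h n m hnm => h n (m + n * k) ?_⟩ <;>
      push_cast <;> linarith)
  obtain ⟨φ, hφ⟩ := Φ.exists_homeomorph_unitAddCircle hΦ1
  have hH : ∀ x, H₂ (Φ x) = H₁ x + σ := fun x => by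
    refine CircleDeg1Lift.map_eq_of_mem_Icc c₂ ?_
    rw [← hΦL, ← hΦR]
    exact ⟨Φ.monotone (CircleDeg1Lift.leftEnd_le c₁ x), Φ.monotone (CircleDeg1Lift.le_rightEnd c₁ x)⟩
  have hK : ∀ x : UnitAddCircle, x ∈ f.K ↔ φ x ∈ g.K := by
    intro x
    induction x using QuotientAddGroup.induction_on with | H x => ?_
    change (x : UnitAddCircle) ∈ f.K ↔ φ (x : UnitAddCircle) ∈ g.K
    rw [hφ, f.coe_mem_K_iff c₁ s₁ hτf, g.coe_mem_K_iff c₂ s₂ hτg, hH, ← hΦL, ← hΦR,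
      Φ.injective.eq_iff, Φ.injective.eq_iff]
  refine ⟨φ.subtype hK, ?_⟩
  rintro ⟨x, hx⟩
  refine Subtype.ext ?_
  change φ (f x) = g (φ x)
  induction x using QuotientAddGroup.induction_on with | H x => ?_
  rw [hφ, f.coe_lift, hφ, g.coe_lift, UnitAddCircle.coe_eq_coe_iff]
  refine ⟨k, ?_⟩
  -- `Φ` need not intertwine the lifts inside fibres, where it is merely affine; at end points both
  -- sides are end points of the same type over values that differ by `k`.
  rcases (f.coe_mem_K_iff c₁ s₁ hτf).1 hx with h | h <;> rw [h]
  · rw [CircleDeg1Lift.semiconj_leftEnd c₁ f.continuous_lift s₁, hΦL, hΦL,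
      CircleDeg1Lift.semiconj_leftEnd c₂ g.continuous_lift s₂, hk,
      ← CircleDeg1Lift.leftEnd_add_int c₂]
    ring_nf
  · rw [CircleDeg1Lift.semiconj_rightEnd c₁ f.continuous_lift s₁, hΦR, hΦR,
      CircleDeg1Lift.semiconj_rightEnd c₂ g.continuous_lift s₂, hk,
      ← CircleDeg1Lift.rightEnd_add_int c₂]
    ring_nf
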